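/- Let $h\ge 1$ and let $\mathcal G_h$ be the half-infinite grid graph on $\mathbb N\times\{0,\dots,h-1\}$ (points are (column, row); two points are adjacent iff their distance is $1$). A *growing self-avoiding walk* (GSAW) is a finite directed walk that visits no vertex twice and whose last vertex is trapped, i.e. all its neighbours in $\mathcal G_h$ lie on the walk. Its displacement is the largest minus the smallest column of its vertices. Let $\mathcal S_{n,k}$ be the set of GSAWs on $\mathcal G_h$ starting at the top-left corner $(0,h-1)$ with $n$ edges and displacement $k$. **Frames.** A *path* is a nonempty sequence of distinct points, consecutive ones adjacent in $\mathcal G_h$; a *segment* is a nonempty ordered list of paths; a *frame* of width $w$ is an ordered list of segments with points in columns $0,\dots,w-1$, in which all the paths are pairwise vertex-disjoint. The *start* of a segment is the first point of its first path, its *end* the last point of its last path. A point is *trapped* in a frame if all its neighbours in the window of the frame are points of the frame. **Extension.** Let $F$ be a frame of width $2$ in which the start of every segment except possibly the first, and the end of every segment except possibly the last, are in the right column $1$. (Any other $F$ has no extensions.) An *extended frame* of $F$ is a frame $X$ of width $3$ obtained from $F$ as follows. (i) The start of every segment but the first and the end of every segment but the last are extended (starts backwards, ends forwards) rightward into the new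 column $2$ and then move up or down any number of edges in that column; the end of the last segment may be extended likewise if it is in column $1$, and the start of the first segment is not extended. (ii) The extended end of a segment may be connected, by an edge of column $2$, to the extended start of the next segment, and the two segments then merge into one; several merges are allowed. (iii) New segments may be inserted anywhere in the list except in the first position; each consists of a single path in column $2$, with at least two points unless it is the last segment of $X$. A new segment may be placed last only if the end of the last segment of $F$ was extended. No points may overlap. Call $X$ *valid* if it has a point in column $2$ and the following holds for the end $e$ of its last segment: if $e$ is in column $1$, or if $e$ is in column $2$ and is the only point of the last segment, then $e$ is trapped in $X$. *Trimming* $X$ means deleting the points of column $0$ with all incident edges (which may split paths into several; the resulting pieces stay in order within their segment) and shifting one column to the left. **The graph $D_h$.** The vertices of $D_h$ are all frames of width $2$ and one extra start vertex $s$. There is an edge $F\to F'$ of weight $x^ny$ whenever $F'$ is the trimming of a valid extended frame of $F$ that has $n$ more edges than $F$. There is an edge $s\to F$ of weight $x^dy$ for every valid first frame $F$, where $d$ is its number of edges; $F$ is a *valid first frame* if every segment is a single path, only the last segment may be a single point, the first segment exists and starts at $(0,h-1)$, all other segments start in column $1$, all segments except possibly the last end in column $1$, and the end of the last segment is trapped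 in $F$ if it is in column $0$ or if the last segment is a single point in column $1$. The accepting vertices are the frames with exactly one segment, whose end is in column $0$. The weight of a walk in $D_h$ is the product of the weights of its edges. **Theorem.** For all $n,k\ge 0$, the set of walks in $D_h$ that start at $s$, end at an accepting vertex and have weight $x^ny^k$ is in bijection with $\mathcal S_{n,k}$. Consequently the transfer matrix method applied to $D_h$ gives the generating function of GSAWs: $D_h$ is finite, each $\mathcal S_{n,k}$ is finite, and if $M$ is the matrix over $\mathbb Z[x,y]$ indexed by the vertices of $D_h$ whose $(u,v)$ entry is the sum of the weights of the edges from $u$ to $v$, then $I-M$ is invertible over $\mathbb Z[[x,y]]$ and $$\sum_{n,k\ge 0}|\mathcal S_{n,k}|\,x^ny^k=\sum_{t\ \text{accepting}}\bigl((I-M)^{-1}\bigr)_{s,t}.$$ -/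

import Mathlib

/-! # Growing self-avoiding walks on a half-infinite strip and their frame machine -/

namespace Strip

/-! ## The strip and its growing self-avoiding walks -/

/-- The half-infinite grid graph of height `h`: its vertices are `(column, row)` with column in `ℕ`
and row in `{0, …, h - 1}`, and two vertices are adjacent when they are at distance one. -/
def grid (h : ℕ) : SimpleGraph (ℕ × Fin h) where
  Adj p q :=
    (p.1 = q.1 ∧ (p.2.val + 1 = q.2.val ∨ q.2.val + 1 = p.2.val)) ∨
    (p.2 = q.2 ∧ (p.1 + 1 = q.1 ∨ q.1 + 1 = p.1))
  symm := ⟨by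
    rintro p q (⟨h1, h2⟩ | ⟨h1, h2⟩)
    · exact Or.inl ⟨h1.symm, h2.symm⟩
    · exact Or.inr ⟨h1.symm, h2.symm⟩⟩
  loopless := ⟨by
    rintro p (⟨_, h2⟩ | ⟨_, h2⟩) <;> omega⟩

/-- The top-left corner `(0, h - 1)`. -/
def topLeft (h : ℕ) (hh : 0 < h) : ℕ × Fin h := (0, ⟨h - 1, by omega⟩)

/-- A growing self-avoiding walk on `G` starting at `v`: a walk that visits no vertex twice and
whose last vertex is trapped, i.e. all neighbours of the last vertex are on the walk. -/
structure GSAW {V : Type*} (G : SimpleGraph V) (v : V) where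
  last : V
  walk : G.Walk v last
  isPath : walk.IsPath
  trapped : ∀ u, G.Adj last u → u ∈ walk.support

/-- The number of edges. -/
def GSAW.length {V : Type*} {G : SimpleGraph V} {v : V} (W : GSAW G v) : ℕ := W.walk.length

/-- The largest minus the smallest column of the vertices of the walk. -/
noncomputable def GSAW.displacement {h : ℕ} {v : ℕ × Fin h} (W : GSAW (grid h) v) : ℕ :=
  sSup (Prod.fst '' {p | p ∈ W.walk.support}) - sInf (Prod.fst '' {p | p ∈ W.walk.support})

/-- The growing self-avoiding walks from the top-left corner with `n` edges and displacement `k`. -/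
abbrev GSAWs (h : ℕ) (hh : 0 < h) (n k : ℕ) : Type :=
  {W : GSAW (grid h) (topLeft h hh) // W.length = n ∧ W.displacement = k}

/-- The series `∑ x ^ length * y ^ displacement` over all growing self-avoiding walks from the
top-left corner, with `x` the variable `0` and `y` the variable `1`. -/
noncomputable def gsawSeries (h : ℕ) (hh : 0 < h) : MvPowerSeries (Fin 2) ℤ :=
  fun m => (Nat.card (GSAWs h hh (m 0) (m 1)) : ℤ)

/-! ## Frames -/

/-- A segment, as an ordered list of paths; each path is the list of the points it visits. -/
abbrev Segment (h : ℕ) : Type := List (List (ℕ × Fin h))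

/-- All points of an ordered list of segments. -/
def vertices {h : ℕ} (F : List (Segment h)) : List (ℕ × Fin h) := F.flatten.flatten

/-- The number of edges of an ordered list of segments. -/
def edgeCount {h : ℕ} (F : List (Segment h)) : ℕ := (F.flatten.map fun P => P.length - 1).sum

/-- `F` is a frame in the window of columns `0, …, w - 1`: an ordered list of nonempty segments,
each an ordered list of nonempty directed paths, in which no point is used twice. -/
structure IsFrame {h : ℕ} (w : ℕ) (F : List (Segment h)) : Prop where
  segment_ne_nil : ∀ S ∈ F, S ≠ []
  path_ne_nil : ∀ S ∈ F, ∀ P ∈ S, P ≠ []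
  isChain : ∀ S ∈ F, ∀ P ∈ S, P.IsChain (grid h).Adj
  nodup : (vertices F).Nodup
  window : ∀ p ∈ vertices F, p.1 < w

/-- The frames of width `w` and height `h`. -/
abbrev Frame (h w : ℕ) : Type := {F : List (Segment h) // IsFrame w F}

/-- The start of a segment (first point of its first path) lies in column `c`. -/
def StartsIn {h : ℕ} (c : ℕ) (S : Segment h) : Prop := ∃ p ∈ S.flatten.head?, p.1 = c

/-- The end of a segment (last point of its last path) lies in column `c`. -/
def EndsIn {h : ℕ} (c : ℕ) (S : Segment h) : Prop := ∃ p ∈ S.flatten.getLast?, p.1 = c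

/-- Every neighbour of `e` in the window of columns `0, …, w - 1` is occupied. -/
def Trapped {h : ℕ} (w : ℕ) (F : List (Segment h)) (e : ℕ × Fin h) : Prop :=
  ∀ q, (grid h).Adj e q → q.1 < w → q ∈ vertices F

/-! ## Extending a frame of width 2 to width 3

The new column is column `2`. -/

/-- Put the points `pre` in front of the first path of a segment. -/
def extendStart {h : ℕ} (pre : List (ℕ × Fin h)) : Segment h → Segment h
  | [] => []
  | P :: S => (pre ++ P) :: S

/-- Put the points `suf` behind the last path of a segment. -/
def extendEnd {h : ℕ} (suf : List (ℕ × Fin h)) : Segment h → Segment h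
  | [] => []
  | [P] => [P ++ suf]
  | P :: Q :: S => P :: extendEnd suf (Q :: S)

/-- The segment obtained when the end of the first segment runs into the start of the second. -/
def joinSegments {h : ℕ} : Segment h → Segment h → Segment h
  | [], T => T
  | [P], [] => [P]
  | [P], Q :: T => (P ++ Q) :: T
  | P :: P' :: S, T => P :: joinSegments (P' :: S) T

/-- `Merges L L'`: `L'` arises from `L` by merging some consecutive segments, the end of each with
the start of the next one. -/
inductive Merges {h : ℕ} : List (Segment h) → List (Segment h) → Prop
  | nil : Merges [] []
  | keep {S : Segment h} {L L' : List (Segment h)} : Merges L L' → Merges (S :: L) (S :: L')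
  | join {S T : Segment h} {L L' : List (Segment h)} :
      Merges (joinSegments S T :: L) L' → Merges (S :: T :: L) L'

/-- `Inserts q L X`: `X` arises from `L` by inserting new segments, each a single path in column
`2`. Only the last segment of `X` may be a new single point, and a new segment may come behind
all segments of `L` only if `q` holds. -/
inductive Inserts {h : ℕ} (q : Prop) : List (Segment h) → List (Segment h) → Prop
  | nil : Inserts q [] []
  | old {S : Segment h} {L X : List (Segment h)} : Inserts q L X → Inserts q (S :: L) (S :: X)
  | new {P : List (ℕ × Fin h)} {L X : List (Segment h)} :
      (∀ p ∈ P, p.1 = 2) → (X ≠ [] → 2 ≤ P.length) → (L = [] → q) →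
      Inserts q L X → Inserts q L ([P] :: X)

/-- The segments of `F`, lengthened by `A`: the entry of `A` for a segment holds the points of the
new column put before its start and those put behind its end. All starts but the first are
extended and all ends but the last; the end of the last segment may be extended. That the new
points continue the paths of `F` along edges, without overlap, is checked on the final frame. -/
structure IsLengthening {h : ℕ} (F : List (Segment h))
    (A : List (List (ℕ × Fin h) × List (ℕ × Fin h))) : Prop where
  length_eq : A.length = F.length
  column : ∀ a ∈ A, ∀ p ∈ a.1 ++ a.2, p.1 = 2
  first_start : ∀ a ∈ A.head?, a.1 = []
  starts : ∀ a ∈ A.tail, a.1 ≠ []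
  ends : ∀ a ∈ A.dropLast, a.2 ≠ []

/-- `X` is an extended frame of `F`. -/
def IsExtension {h : ℕ} (F : Frame h 2) (X : Frame h 3) : Prop :=
  (∀ S ∈ F.1.tail, StartsIn 1 S) ∧ (∀ S ∈ F.1.dropLast, EndsIn 1 S) ∧
  ∃ A, IsLengthening F.1 A ∧
    ∃ (S : Segment h) (L X' : List (Segment h)),
      Merges (List.zipWith (fun a T => extendEnd a.2 (extendStart a.1 T)) A F.1) (S :: L) ∧
      Inserts (∃ a ∈ A.getLast?, a.2 ≠ []) L X' ∧
      X.1 = S :: X'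

/-- `X` is an extended frame of `F` that may be part of a growing self-avoiding walk. The new
column is really used, and if the end of the last segment is the last point of the walk because it
was left behind in the middle column, or because it is a segment of its own in the new column, then
it is trapped. (An end in the leftmost column was left behind earlier and needs no new test.) -/
def IsValidExtension {h : ℕ} (F : Frame h 2) (X : Frame h 3) : Prop :=
  IsExtension F X ∧ (∃ p ∈ vertices X.1, p.1 = 2) ∧
  ∀ S ∈ X.1.getLast?, ∀ e ∈ S.flatten.getLast?,
    (e.1 = 1 ∨ (e.1 = 2 ∧ S = [[e]])) → Trapped 3 X.1 e

/-- Remove column `0` with all incident edges, splitting paths where needed, and move the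
remaining points one column to the left. -/
def trim {h : ℕ} (X : List (Segment h)) : List (Segment h) :=
  X.map fun S =>
    ((S.flatMap fun P => P.splitOnP fun p => p.1 == 0).filter fun P => !P.isEmpty).map
      fun P => P.map fun p => (p.1 - 1, p.2)

/-- The valid first frames. -/
structure IsFirstFrame {h : ℕ} (F : List (Segment h)) : Prop where
  single_path : ∀ S ∈ F, S.length = 1
  not_point : ∀ S ∈ F.dropLast, 2 ≤ S.flatten.length
  corner : ∃ S ∈ F.head?, ∃ p ∈ S.flatten.head?, p.1 = 0 ∧ p.2.val + 1 = h
  starts : ∀ S ∈ F.tail, StartsIn 1 S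
  ends : ∀ S ∈ F.dropLast, EndsIn 1 S
  trapped : ∀ S ∈ F.getLast?, ∀ e ∈ S.flatten.getLast?,
    (e.1 = 0 ∨ (e.1 = 1 ∧ S = [[e]])) → Trapped 2 F e

/-! ## The weighted directed graph -/

/-- The vertices of the directed graph: the start vertex and all frames of width 2. -/
inductive State (h : ℕ) : Type
  | start : State h
  | frame (F : Frame h 2) : State h

/-- `HasEdge u v n`: there is an edge from `u` to `v` that adds `n` edges of the strip. -/
def HasEdge {h : ℕ} : State h → State h → ℕ → Prop
  | .start, .frame F, n => IsFirstFrame F.1 ∧ n = edgeCount F.1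
  | .frame F, .frame F', n =>
      ∃ X : Frame h 3, IsValidExtension F X ∧ F'.1 = trim X.1 ∧ edgeCount X.1 = edgeCount F.1 + n
  | _, .start, _ => False

/-- The directed graph of frames. -/
instance instQuiverState (h : ℕ) : Quiver (State h) := ⟨fun u v => {n : ℕ // HasEdge u v n}⟩

/-- The weight `x ^ n * y` of an edge. -/
noncomputable def edgeWeight {h : ℕ} {u v : State h} (e : u ⟶ v) : MvPolynomial (Fin 2) ℤ :=
  MvPolynomial.X 0 ^ e.1 * MvPolynomial.X 1

/-- The accepting vertices: frames with one segment whose end is in the left column. -/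
def IsAccepting {h : ℕ} : State h → Prop
  | .start => False
  | .frame F => ∃ S, F.1 = [S] ∧ EndsIn 0 S

abbrev AcceptingState (h : ℕ) : Type := {t : State h // IsAccepting t}

/-- The walks from the start vertex to an accepting vertex whose weight, the product of the weights
of their edges, is `x ^ n * y ^ k`. -/
abbrev AcceptedWalks (h n k : ℕ) : Type :=
  {w : Σ t : AcceptingState h, Quiver.Path (State.start : State h) t.1 //
    w.2.weight edgeWeight = MvPolynomial.X 0 ^ n * MvPolynomial.X 1 ^ k}

/-! ## Finiteness and the transfer matrix -/

theorem finite_lists {α : Type*} {s : Set α} (hs : s.Finite) (n : ℕ) :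
    {l : List α | (∀ x ∈ l, x ∈ s) ∧ l.length ≤ n}.Finite := by
  have : Finite s := hs
  refine ((List.finite_length_le s n).image (List.map Subtype.val)).subset ?_
  rintro l ⟨h1, h2⟩
  refine ⟨l.attach.map fun x => ⟨x.1, h1 x.1 x.2⟩, by simpa using h2, ?_⟩
  simp

theorem length_le_length_flatten {α : Type*} {L : List (List α)} (hL : ∀ l ∈ L, l ≠ []) :
    L.length ≤ L.flatten.length := by
  induction L with
  | nil => simp
  | cons a L ih =>
    have h1 := ih fun l hl => hL l (by simp [hl])
    have h2 := List.length_pos_iff.2 (hL a (by simp))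
    simp only [List.length_cons, List.flatten_cons, List.length_append]
    omega

theorem length_le_of_mem {α : Type*} {L : List (List α)} {l : List α} (hl : l ∈ L) :
    l.length ≤ L.flatten.length :=
  (List.sublist_flatten_of_mem hl).length_le

instance finite_frame (h w : ℕ) : Finite (Frame h w) := by
  have hp : {p : ℕ × Fin h | p.1 < w}.Finite :=
    ((Set.finite_lt_nat w).prod (Set.finite_univ (α := Fin h))).subset fun p hp => ⟨hp, trivial⟩
  obtain ⟨N, hN⟩ : ∃ N : ℕ, ∀ l : List (ℕ × Fin h), l.Nodup → (∀ p ∈ l, p.1 < w) →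
      l.length ≤ N := by
    refine ⟨hp.toFinset.card, fun l hl hlw => ?_⟩
    rw [← List.toFinset_card_of_nodup hl]
    exact Finset.card_le_card fun p hpl => by simpa using hlw p (by simpa using hpl)
  refine ((finite_lists (finite_lists (finite_lists hp N) N) N).subset ?_).to_subtype
  intro F hF
  have hv := hN _ hF.nodup hF.window
  have hP : ∀ P ∈ F.flatten, P ≠ [] := by
    intro P hP
    obtain ⟨S, hS, hPS⟩ := List.mem_flatten.1 hP
    exact hF.path_ne_nil S hS P hPS
  have h1 : F.flatten.length ≤ N := (length_le_length_flatten hP).trans hv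
  refine ⟨fun S hS => ⟨fun P hPS => ⟨fun p hpP => ?_, ?_⟩, ?_⟩, ?_⟩
  · exact hF.window p (List.mem_flatten.2 ⟨P, List.mem_flatten.2 ⟨S, hS, hPS⟩, hpP⟩)
  · exact (length_le_of_mem (List.mem_flatten.2 ⟨S, hS, hPS⟩)).trans hv
  · exact (length_le_of_mem hS).trans h1
  · exact (length_le_length_flatten hF.segment_ne_nil).trans h1

instance finite_state (h : ℕ) : Finite (State h) :=
  Finite.of_surjective
    (fun o : Option (Frame h 2) => match o with | none => State.start | some F => State.frame F)
    (by rintro (_ | F); exacts [⟨none, rfl⟩, ⟨some F, rfl⟩])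

instance finite_hom {h : ℕ} (u v : State h) : Finite (u ⟶ v) := by
  have key : ∀ m : ℕ, {n : ℕ | ∃ X : Frame h 3, edgeCount X.1 = m + n}.Finite := fun m =>
    (Set.finite_range fun X : Frame h 3 => edgeCount X.1 - m).subset
      (by rintro n ⟨X, hX⟩; exact ⟨X, by simp [hX]⟩)
  suffices hf : {n : ℕ | HasEdge u v n}.Finite from hf.to_subtype
  rcases u with _ | F <;> rcases v with _ | F'
  · simp [HasEdge]
  · exact (Set.finite_singleton (edgeCount F'.1)).subset fun n (hn : _ ∧ _) => hn.2
  · simp [HasEdge]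
  · refine (key (edgeCount F.1)).subset ?_
    rintro n ⟨X, hX⟩
    exact ⟨X, hX.2.2⟩

noncomputable instance instFintypeState (h : ℕ) : Fintype (State h) := Fintype.ofFinite _

noncomputable instance instDecidableEqState (h : ℕ) : DecidableEq (State h) := Classical.decEq _

noncomputable instance instFintypeHom {h : ℕ} (u v : State h) : Fintype (u ⟶ v) :=
  Fintype.ofFinite _

noncomputable instance instFintypeAccepting (h : ℕ) : Fintype (AcceptingState h) :=
  Fintype.ofFinite _

/-- The adjacency matrix: the entry at `(u, v)` is the sum of the weights of the edges from `u`
to `v`. -/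
noncomputable def adjacency (h : ℕ) : Matrix (State h) (State h) (MvPolynomial (Fin 2) ℤ) :=
  Matrix.of fun u v => ∑ e : (u ⟶ v), edgeWeight e

/-- `1 - M` for the adjacency matrix `M`, over the ring of formal power series in `x` and `y`. -/
noncomputable def oneSubAdjacency (h : ℕ) :
    Matrix (State h) (State h) (MvPowerSeries (Fin 2) ℤ) :=
  1 - (adjacency h).map fun p => (p : MvPowerSeries (Fin 2) ℤ)

end Strip

/-!
Cutting a growing self-avoiding walk along the columns `≤ c` leaves an ordered list of paths, a
partial walk, and a frame is what remains of a partial walk when only its last two columns are kept.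
Deleting the last column of a partial walk is an extension of frames read backwards. Conversely, the
paths of a frame meet the older part of the partial walk only in the left column of the frame, so an
extension of the frame carries over to the whole partial walk. A directed walk of frames from the
start vertex is therefore the sequence of views of one partial walk, and an accepting frame says
that this partial walk is a single trapped path. The views determine the path, because each of its
edges lies in some pair of consecutive columns.

Every entry of the adjacency matrix `M` is divisible by `y`, so `(1 - M)⁻¹` is the sum of the powers
of `M`, coefficient by coefficient a finite sum over directed walks.
-/

namespace Strip

/-! ## Consecutive pairs and maximal runs of a list -/

section Lists

variable {α β : Type*} {p q : α → Bool}

theorem consecutivePairs_cons_cons (a b : α) (l : List α) :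
    (a :: b :: l).consecutivePairs = (a, b) :: (b :: l).consecutivePairs := rfl

@[simp] theorem consecutivePairs_singleton (a : α) : [a].consecutivePairs = [] := rfl

theorem consecutivePairs_map (f : α → β) (l : List α) :
    (l.map f).consecutivePairs = l.consecutivePairs.map (Prod.map f f) := by
  rw [List.consecutivePairs, ← List.map_tail, List.zip_map]

theorem mem_consecutivePairs_iff_infix {l : List α} {x : α × α} :
    x ∈ l.consecutivePairs ↔ [x.1, x.2] <:+: l := by
  induction l with
  | nil => simp
  | cons a l ih =>
    cases l with
    | nil => simp [List.infix_cons_iff]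
    | cons b l =>
      rw [consecutivePairs_cons_cons, List.mem_cons, ih, List.infix_cons_iff (l₂ := b :: l)]
      simp [Prod.ext_iff]

theorem isChain_iff_forall_mem_consecutivePairs {R : α → α → Prop} {l : List α} :
    l.IsChain R ↔ ∀ x ∈ l.consecutivePairs, R x.1 x.2 := by
  simp only [List.isChain_iff_forall_rel_of_append_cons_cons, mem_consecutivePairs_iff_infix]
  exact ⟨fun h x ⟨l₁, l₂, hl⟩ => h (by simpa using hl.symm),
    fun h a b l₁ l₂ hl => h (a, b) ⟨l₁, l₂, by simpa using hl.symm⟩⟩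

theorem mem_of_mem_consecutivePairs {l : List α} {x : α × α} (hx : x ∈ l.consecutivePairs) :
    x.1 ∈ l ∧ x.2 ∈ l :=
  (List.of_mem_zip hx).imp_right List.mem_of_mem_tail

theorem mem_consecutivePairs_of_infix {l m : List α} (hlm : l <:+: m) {x : α × α}
    (hx : x ∈ l.consecutivePairs) : x ∈ m.consecutivePairs :=
  mem_consecutivePairs_iff_infix.2 ((mem_consecutivePairs_iff_infix.1 hx).trans hlm)

theorem mk_mem_consecutivePairs_append {l m : List α} {a b : α} (ha : a ∈ l.getLast?)
    (hb : b ∈ m.head?) : (a, b) ∈ (l ++ m).consecutivePairs := by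
  obtain ⟨l, rfl⟩ := List.getLast?_eq_some_iff.1 ha
  obtain ⟨m, rfl⟩ := List.head?_eq_some_iff.1 hb
  exact mem_consecutivePairs_iff_infix.2 ⟨l, m, by simp⟩

theorem mem_consecutivePairs_cons_iff {a : α} {l : List α} (ha : a ∉ l) {x : α × α} :
    x ∈ l.consecutivePairs ↔ x ∈ (a :: l).consecutivePairs ∧ x.1 ≠ a := by
  constructor
  · intro hx
    refine ⟨mem_consecutivePairs_of_infix (List.suffix_cons a l).isInfix hx, ?_⟩
    rintro rfl
    exact ha (mem_of_mem_consecutivePairs hx).1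
  · rintro ⟨hx, hne⟩
    cases l with
    | nil => simp at hx
    | cons b l =>
      rw [consecutivePairs_cons_cons, List.mem_cons] at hx
      exact hx.resolve_left fun h => hne (congrArg Prod.fst h)

theorem mem_head?_iff_mk_mem_consecutivePairs {a : α} {l : List α} (ha : a ∉ l) (b : α) :
    b ∈ l.head? ↔ (a, b) ∈ (a :: l).consecutivePairs := by
  cases l with
  | nil => simp
  | cons c l =>
    rw [consecutivePairs_cons_cons, List.mem_cons,
      or_iff_left fun h => ha (mem_of_mem_consecutivePairs h).1]
    simp [eq_comm]

theorem eq_of_consecutivePairs {l m : List α} (hl : l.Nodup) (hm : m.Nodup)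
    (hhead : l.head? = m.head?)
    (hpairs : ∀ x, x ∈ l.consecutivePairs ↔ x ∈ m.consecutivePairs) : l = m := by
  induction l generalizing m with
  | nil => simpa [eq_comm] using hhead
  | cons a l ih =>
    obtain ⟨m, rfl⟩ := List.head?_eq_some_iff.1 hhead.symm
    rw [List.nodup_cons] at hl hm
    rw [ih hl.2 hm.2
      (Option.ext fun b => by
        rw [← Option.mem_def, ← Option.mem_def, mem_head?_iff_mk_mem_consecutivePairs hl.1,
          mem_head?_iff_mk_mem_consecutivePairs hm.1, hpairs])
      fun x => by
        rw [mem_consecutivePairs_cons_iff hl.1, mem_consecutivePairs_cons_iff hm.1, hpairs]]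

theorem isChain_and_iff {P Q : α → Prop} {l : List α} :
    l.IsChain (fun x y => P x ∧ Q y) ↔ (∀ x ∈ l.dropLast, P x) ∧ ∀ y ∈ l.tail, Q y := by
  induction l with
  | nil => simp
  | cons a l ih =>
    cases l with
    | nil => simp
    | cons b l =>
      simp only [List.isChain_cons_cons, ih, List.dropLast_cons_cons, List.mem_cons,
        List.tail_cons, forall_eq_or_imp]
      tauto

/-- The maximal blocks of consecutive entries of a list that satisfy `p`. -/
def runs (p : α → Bool) (l : List α) : List (List α) :=
  (l.splitOnP fun a => !p a).filter fun P => !P.isEmpty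

@[simp] theorem runs_nil : runs p ([] : List α) = [] := by simp [runs]

theorem runs_cons_neg {a : α} (ha : p a = false) (l : List α) : runs p (a :: l) = runs p l := by
  simp [runs, List.splitOnP_cons_eq_if_modifyHead, ha]

theorem runs_singleton {a : α} (ha : p a = true) : runs p [a] = [[a]] := by
  simp [runs, List.splitOnP_cons_eq_if_modifyHead, ha]

theorem runs_cons_cons_neg {a b : α} (ha : p a = true) (hb : p b = false) (l : List α) :
    runs p (a :: b :: l) = [a] :: runs p (b :: l) := by
  simp [runs, List.splitOnP_cons_eq_if_modifyHead, ha, hb]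

theorem exists_runs_cons_cons {a b : α} (ha : p a = true) (hb : p b = true) (l : List α) :
    ∃ t R, runs p (b :: l) = (b :: t) :: R ∧ runs p (a :: b :: l) = (a :: b :: t) :: R := by
  obtain ⟨t, R, h⟩ := List.exists_cons_of_ne_nil (List.splitOnP_ne_nil (fun a => !p a) l)
  refine ⟨t, R.filter fun P => !P.isEmpty, ?_⟩
  simp [runs, List.splitOnP_cons_eq_if_modifyHead, ha, hb, h]

theorem runs_induction {motive : List α → Prop} (p : α → Bool) (nil : motive [])
    (neg : ∀ a l, p a = false → motive l → motive (a :: l))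
    (single : ∀ a, p a = true → motive [a])
    (cons_neg : ∀ a b l, p a = true → p b = false → motive (b :: l) → motive (a :: b :: l))
    (cons_pos : ∀ a b l t R, p a = true → p b = true → runs p (b :: l) = (b :: t) :: R →
      runs p (a :: b :: l) = (a :: b :: t) :: R → motive (b :: l) → motive (a :: b :: l))
    (l : List α) : motive l := by
  induction l with
  | nil => exact nil
  | cons a l ih =>
    cases ha : p a with
    | false => exact neg a l ha ih
    | true =>
      cases l with
      | nil => exact single a ha
      | cons b l =>
        cases hb : p b with
        | false => exact cons_neg a b l ha hb ih
        | true =>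
          obtain ⟨t, R, hbl, habl⟩ := exists_runs_cons_cons ha hb l
          exact cons_pos a b l t R ha hb hbl habl ih

theorem ne_nil_of_mem_runs {l P : List α} (hP : P ∈ runs p l) : P ≠ [] := by
  rintro rfl
  simp [runs] at hP

theorem flatten_runs (l : List α) : (runs p l).flatten = l.filter p := by
  induction l using runs_induction p with
  | nil => rfl
  | neg a l ha ih => simp [runs_cons_neg ha, ha, ih]
  | single a ha => simp [runs_singleton ha, ha]
  | cons_neg a b l ha hb ih => simp [runs_cons_cons_neg ha hb, ha, ih]
  | cons_pos a b l t R ha hb hbl habl ih => simp_all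

theorem runs_eq_singleton {l : List α} (hl : l ≠ []) (h : ∀ a ∈ l, p a = true) :
    runs p l = [l] := by
  rw [runs, List.splitOnP_eq_singleton (by simpa using h)]
  simp [hl]

theorem runs_eq_nil {l : List α} (h : ∀ a ∈ l, p a = false) : runs p l = [] := by
  have hflatten : (runs p l).flatten = [] := by
    simpa [flatten_runs, List.filter_eq_nil_iff] using h
  refine List.eq_nil_iff_forall_not_mem.2 fun P hP => ne_nil_of_mem_runs hP ?_
  exact List.flatten_eq_nil_iff.1 hflatten P hP

theorem runs_ne_nil {l : List α} {a : α} (ha : a ∈ l) (hp : p a = true) : runs p l ≠ [] := by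
  intro h
  have hmem : a ∈ (runs p l).flatten := flatten_runs (p := p) l ▸ List.mem_filter.2 ⟨ha, hp⟩
  simp [h] at hmem

theorem flatMap_consecutivePairs_runs (l : List α) :
    (runs p l).flatMap List.consecutivePairs =
      l.consecutivePairs.filter fun x => p x.1 && p x.2 := by
  induction l using runs_induction p with
  | nil => rfl
  | neg a l ha ih =>
    rw [runs_cons_neg ha, ih]
    cases l with
    | nil => rfl
    | cons b l => simp [consecutivePairs_cons_cons, ha]
  | single a ha => simp [runs_singleton ha]
  | cons_neg a b l ha hb ih =>
    simp [runs_cons_cons_neg ha hb, ih, consecutivePairs_cons_cons, hb]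
  | cons_pos a b l t R ha hb hbl habl ih =>
    rw [hbl, List.flatMap_cons] at ih
    rw [habl, List.flatMap_cons, consecutivePairs_cons_cons, List.cons_append, ih,
      consecutivePairs_cons_cons, List.filter_cons_of_pos (by simp [ha, hb])]

theorem runs_map (f : α → β) (r : β → Bool) (l : List α) :
    runs r (l.map f) = (runs (r ∘ f) l).map (List.map f) := by
  induction l using runs_induction (r ∘ f) with
  | nil => simp
  | neg a l ha ih => rw [List.map_cons, runs_cons_neg (p := r) ha, runs_cons_neg ha, ih]
  | single a ha => simp [runs_singleton (p := r) ha, runs_singleton ha]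
  | cons_neg a b l ha hb ih =>
    simp only [List.map_cons, runs_cons_cons_neg ha hb] at ih ⊢
    rw [runs_cons_cons_neg (p := r) ha hb, ih]
    rfl
  | cons_pos a b l t R ha hb hbl habl ih =>
    obtain ⟨u, U, hu, hau⟩ := exists_runs_cons_cons (p := r) (a := f a) (b := f b) ha hb (l.map f)
    rw [List.map_cons, hu, hbl] at ih
    rw [List.map_cons, List.map_cons, hau, habl]
    simpa using ih

theorem flatMap_runs_runs (hqp : ∀ a, q a = true → p a = true) (l : List α) :
    (runs p l).flatMap (runs q) = runs q l := by
  have hn : ∀ a, p a = false → q a = false := fun a ha => by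
    by_contra h; simp [hqp a (by simpa using h)] at ha
  induction l using runs_induction p with
  | nil => simp
  | neg a l ha ih => rw [runs_cons_neg ha, runs_cons_neg (hn a ha), ih]
  | single a ha => simp [runs_singleton ha]
  | cons_neg a b l ha hb ih =>
    rw [runs_cons_cons_neg ha hb, List.flatMap_cons, ih, runs_cons_neg (hn b hb)]
    cases hq : q a with
    | false => simp [runs_cons_neg hq, runs_cons_neg (hn b hb)]
    | true =>
      simp [runs_cons_cons_neg hq (hn b hb), runs_singleton hq, runs_cons_neg (hn b hb)]
  | cons_pos a b l t R _ _ hbl habl ih =>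
    rw [hbl, List.flatMap_cons] at ih
    rw [habl, List.flatMap_cons]
    cases hq : q a with
    | false => rw [runs_cons_neg hq, ih, runs_cons_neg hq]
    | true =>
      cases hqb : q b with
      | false => rw [runs_cons_cons_neg hq hqb, List.cons_append, ih, runs_cons_cons_neg hq hqb]
      | true =>
        obtain ⟨t₁, R₁, h₁, h₁'⟩ := exists_runs_cons_cons hq hqb t
        obtain ⟨t₂, R₂, h₂, h₂'⟩ := exists_runs_cons_cons hq hqb l
        rw [h₁, h₂] at ih
        rw [h₁', h₂']
        simpa using ih

theorem runs_append {l m : List α}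
    (h : (∀ a ∈ l.getLast?, p a = false) ∨ ∀ b ∈ m.head?, p b = false) :
    runs p (l ++ m) = runs p l ++ runs p m := by
  induction l using runs_induction p with
  | nil => simp
  | neg a l ha ih =>
    rw [List.cons_append, runs_cons_neg ha, runs_cons_neg ha]
    cases l with
    | nil => simp
    | cons b l => exact ih (by simpa [List.getLast?_cons_cons] using h)
  | single a ha =>
    cases m with
    | nil => simp
    | cons b m =>
      have hb : p b = false := by simpa [ha] using h
      simpa [runs_singleton ha] using runs_cons_cons_neg ha hb m
  | cons_neg a b l ha hb ih =>
    have ih := ih (by simpa [List.getLast?_cons_cons] using h)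
    simp only [List.cons_append] at ih ⊢
    rw [runs_cons_cons_neg ha hb, runs_cons_cons_neg ha hb, ih, List.cons_append]
  | cons_pos a b l t R ha hb hbl habl ih =>
    have ih := ih (by simpa [List.getLast?_cons_cons] using h)
    obtain ⟨u, U, hu, hau⟩ := exists_runs_cons_cons ha hb (l ++ m)
    rw [List.cons_append, hu, hbl] at ih
    rw [List.cons_append, List.cons_append, hau, habl]
    simpa using ih

end Lists

section Segments

variable {h : ℕ} {p : ℕ × Fin h → Bool}

theorem runs_append_joinSegments {l m : List (ℕ × Fin h)} (hl : l ≠ [])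
    (hl' : ∀ a ∈ l.getLast?, p a = true) {b : ℕ × Fin h} (hb : b ∈ m.head?) (hpb : p b = true) :
    runs p (l ++ m) = joinSegments (runs p l) (runs p m) := by
  obtain ⟨m, rfl⟩ := List.head?_eq_some_iff.1 hb
  obtain ⟨t₀, R₀, hm, -⟩ := exists_runs_cons_cons hpb hpb m
  induction l using runs_induction p with
  | nil => contradiction
  | neg a l ha ih =>
    rw [List.cons_append, runs_cons_neg ha, runs_cons_neg ha]
    cases l with
    | nil => simp [ha] at hl'
    | cons c l => exact ih (by simp) (by simpa [List.getLast?_cons_cons] using hl')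
  | single a ha =>
    obtain ⟨t, R, h₁, h₂⟩ := exists_runs_cons_cons ha hpb m
    simp [h₁, h₂, runs_singleton ha, joinSegments]
  | cons_neg a c l ha hc ih =>
    have hlast : ∀ x ∈ (c :: l).getLast?, p x = true := by
      simpa [List.getLast?_cons_cons] using hl'
    have hne : runs p (c :: l) ≠ [] :=
      runs_ne_nil (List.getLast_mem (List.cons_ne_nil c l))
        (hlast _ (by simp [List.getLast?_eq_some_getLast]))
    obtain ⟨u, U, hu⟩ := List.exists_cons_of_ne_nil hne
    have ih := ih (by simp) hlast
    simp only [List.cons_append] at ih ⊢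
    rw [runs_cons_cons_neg ha hc, runs_cons_cons_neg ha hc, ih, hu, joinSegments]
  | cons_pos a c l t R ha hc hbl habl ih =>
    have ih := ih (by simp) (by simpa [List.getLast?_cons_cons] using hl')
    obtain ⟨u, U, hu, hau⟩ := exists_runs_cons_cons ha hc (l ++ b :: m)
    rw [List.cons_append, hu, hbl, hm] at ih
    rw [List.cons_append, List.cons_append, hau, habl, hm]
    cases R <;> simp_all [joinSegments]

theorem runs_append_extendStart {pre l : List (ℕ × Fin h)} (hl : l ≠ [])
    (hpre : ∀ a ∈ pre, p a = true) (hhead : pre ≠ [] → ∀ a ∈ l.head?, p a = true) :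
    runs p (pre ++ l) = extendStart pre (runs p l) := by
  cases pre with
  | nil => cases h : runs p l <;> simp [extendStart, h]
  | cons c pre =>
    obtain ⟨b, l, rfl⟩ := List.exists_cons_of_ne_nil hl
    have hb : p b = true := hhead (by simp) b (by simp)
    obtain ⟨t, R, hrun, -⟩ := exists_runs_cons_cons hb hb l
    rw [runs_append_joinSegments (by simp) (fun a ha => hpre a (List.mem_of_getLast? ha))
      (b := b) (by simp) hb, runs_eq_singleton (by simp) hpre, hrun]
    rfl

theorem joinSegments_singleton {S : Segment h} (hS : S ≠ []) (suf : List (ℕ × Fin h)) :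
    joinSegments S [suf] = extendEnd suf S := by
  induction S with
  | nil => contradiction
  | cons P S ih =>
    cases S with
    | nil => rfl
    | cons Q S => simpa [joinSegments, extendEnd] using ih

@[simp] theorem extendEnd_nil (S : Segment h) : extendEnd [] S = S := by
  induction S with
  | nil => rfl
  | cons P S ih =>
    cases S with
    | nil => simp [extendEnd]
    | cons Q S => simpa [extendEnd] using ih

theorem runs_append_extendEnd {l suf : List (ℕ × Fin h)} (hl : l ≠ [])
    (hsuf : ∀ a ∈ suf, p a = true) (hlast : suf ≠ [] → ∀ a ∈ l.getLast?, p a = true) :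
    runs p (l ++ suf) = extendEnd suf (runs p l) := by
  cases suf with
  | nil => simp
  | cons c suf =>
    have hlast := hlast (by simp)
    rw [runs_append_joinSegments hl hlast (b := c) (by simp) (hsuf c (by simp)),
      runs_eq_singleton (by simp) hsuf, joinSegments_singleton]
    exact runs_ne_nil (List.getLast_mem hl) (hlast _ (by simp [List.getLast?_eq_some_getLast hl]))

theorem map_extendStart (f : ℕ × Fin h → ℕ × Fin h) (pre : List (ℕ × Fin h)) (S : Segment h) :
    (extendStart pre S).map (List.map f) = extendStart (pre.map f) (S.map (List.map f)) := by
  cases S <;> simp [extendStart]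

theorem map_joinSegments (f : ℕ × Fin h → ℕ × Fin h) (S T : Segment h) :
    (joinSegments S T).map (List.map f) =
      joinSegments (S.map (List.map f)) (T.map (List.map f)) := by
  induction S with
  | nil => cases T <;> rfl
  | cons P S ih =>
    cases S with
    | nil => cases T <;> simp [joinSegments]
    | cons Q S => simpa [joinSegments] using ih

theorem map_extendEnd (f : ℕ × Fin h → ℕ × Fin h) (suf : List (ℕ × Fin h)) (S : Segment h) :
    (extendEnd suf S).map (List.map f) = extendEnd (suf.map f) (S.map (List.map f)) := by
  cases S with
  | nil => rfl
  | cons P S =>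
    rw [← joinSegments_singleton (by simp), map_joinSegments]
    exact joinSegments_singleton (by simp) _

end Segments

/-! ## Walks seen through a window of columns -/

section Arcs

variable {α : Type*}

/-- The directed edges of a list of paths. -/
def arcs (G : List (List α)) : List (α × α) := G.flatMap List.consecutivePairs

theorem mem_arcs {G : List (List α)} {x : α × α} :
    x ∈ arcs G ↔ ∃ P ∈ G, x ∈ P.consecutivePairs := List.mem_flatMap

@[simp] theorem arcs_nil : arcs ([] : List (List α)) = [] := rfl

@[simp] theorem arcs_cons (P : List α) (G : List (List α)) :
    arcs (P :: G) = P.consecutivePairs ++ arcs G := rfl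

@[simp] theorem arcs_append (G G' : List (List α)) : arcs (G ++ G') = arcs G ++ arcs G' :=
  List.flatMap_append

theorem forall_isChain_iff_forall_mem_arcs {R : α → α → Prop} {G : List (List α)} :
    (∀ P ∈ G, P.IsChain R) ↔ ∀ x ∈ arcs G, R x.1 x.2 := by
  simp only [mem_arcs, isChain_iff_forall_mem_consecutivePairs]
  exact ⟨fun H x ⟨P, hP, hx⟩ => H P hP x hx, fun H P hP x hx => H x ⟨P, hP, hx⟩⟩

theorem arcs_map {β : Type*} (f : α → β) (G : List (List α)) :
    arcs (G.map (List.map f)) = (arcs G).map (Prod.map f f) := by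
  rw [arcs, arcs, List.flatMap_map, List.map_flatMap]
  simp only [consecutivePairs_map]

theorem arcs_flatMap_runs (p : α → Bool) (G : List (List α)) :
    arcs (G.flatMap (runs p)) = (arcs G).filter fun x => p x.1 && p x.2 := by
  rw [arcs, arcs, List.flatMap_assoc, List.filter_flatMap]
  simp only [flatMap_consecutivePairs_runs]

theorem flatten_flatMap_runs (p : α → Bool) (G : List (List α)) :
    (G.flatMap (runs p)).flatten = G.flatten.filter p := by
  induction G with
  | nil => rfl
  | cons P G ih => simp [ih, flatten_runs]

theorem length_add_length_filter_and {p q : α → Bool} {l : List α}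
    (hl : ∀ x ∈ l, p x = true ∨ q x = true) :
    l.length + (l.filter fun x => p x && q x).length =
      (l.filter p).length + (l.filter q).length := by
  induction l with
  | nil => rfl
  | cons a l ih =>
    have ih := ih fun x hx => hl x (List.mem_cons_of_mem _ hx)
    have := hl a (by simp)
    cases hp : p a <;> cases hq : q a <;> simp_all <;> omega

end Arcs

section PartialWalks

variable {h : ℕ}

theorem edgeCount_eq_length_arcs (F : List (Segment h)) :
    edgeCount F = (arcs F.flatten).length := by
  simp [edgeCount, arcs, List.length_flatMap]

theorem col_le_of_adj {a b : ℕ × Fin h} (hab : (grid h).Adj a b) :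
    a.1 ≤ b.1 + 1 ∧ b.1 ≤ a.1 + 1 := by
  rcases hab with ⟨hcol, _⟩ | ⟨_, hcol⟩ <;> omega

theorem row_eq_of_adj {a b : ℕ × Fin h} (hab : (grid h).Adj a b) (hne : a.1 ≠ b.1) :
    a.2 = b.2 := by
  rcases hab with ⟨hcol, _⟩ | ⟨hrow, _⟩
  · exact absurd hcol hne
  · exact hrow

theorem eq_mk_of_adj {c : ℕ} {a b : ℕ × Fin h} (hab : (grid h).Adj a b) (ha : a.1 = c + 1)
    (hb : b.1 ≤ c) : b = (c, a.2) := by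
  have hcol := col_le_of_adj hab
  exact Prod.ext (by simp only; omega) (row_eq_of_adj hab (by omega)).symm

/-- Move a point `i` columns to the left. -/
def shift (i : ℕ) (p : ℕ × Fin h) : ℕ × Fin h := (p.1 - i, p.2)

theorem adj_shift {i : ℕ} {a b : ℕ × Fin h} (ha : i ≤ a.1) (hb : i ≤ b.1) :
    (grid h).Adj (shift i a) (shift i b) ↔ (grid h).Adj a b := by
  have hcol : a.1 - i = b.1 - i ↔ a.1 = b.1 := by omega
  have hright : a.1 - i + 1 = b.1 - i ↔ a.1 + 1 = b.1 := by omega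
  have hleft : b.1 - i + 1 = a.1 - i ↔ b.1 + 1 = a.1 := by omega
  simp only [grid, shift]
  rw [hcol, hright, hleft]

theorem shift_inj {i : ℕ} {a b : ℕ × Fin h} (ha : i ≤ a.1) (hb : i ≤ b.1) :
    shift i a = shift i b ↔ a = b := by
  simp only [shift, Prod.ext_iff]
  omega

/-- The part of a path in the columns `≥ i`, moved `i` columns to the left. -/
def window (i : ℕ) (P : List (ℕ × Fin h)) : Segment h :=
  (runs (fun p => decide (i ≤ p.1)) P).map (List.map (shift i))

theorem window_ne_nil {i : ℕ} {P : List (ℕ × Fin h)} {p : ℕ × Fin h} (hp : p ∈ P)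
    (hi : i ≤ p.1) : window i P ≠ [] := by
  simpa [window] using runs_ne_nil (p := fun p => decide (i ≤ p.1)) hp (by simpa using hi)

theorem window_eq_singleton {i : ℕ} {P : List (ℕ × Fin h)} (hP : P ≠ []) (hi : ∀ p ∈ P, i ≤ p.1) :
    window i P = [P.map (shift i)] := by
  rw [window, runs_eq_singleton hP (by simpa using hi)]
  rfl

theorem flatten_window (i : ℕ) (P : List (ℕ × Fin h)) :
    (window i P).flatten = (P.filter fun p => decide (i ≤ p.1)).map (shift i) := by
  rw [window, ← List.map_flatten, flatten_runs]

theorem flatten_map_window (i : ℕ) (G : List (List (ℕ × Fin h))) :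
    (G.map (window i)).flatten =
      (G.flatMap (runs fun p => decide (i ≤ p.1))).map (List.map (shift i)) := by
  rw [← List.flatMap_def, List.map_flatMap]
  rfl

theorem vertices_map_window (i : ℕ) (G : List (List (ℕ × Fin h))) :
    vertices (G.map (window i)) = (G.flatten.filter fun p => decide (i ≤ p.1)).map (shift i) := by
  rw [vertices, flatten_map_window, ← List.map_flatten, flatten_flatMap_runs]

theorem shift_mem_vertices_map_window {i : ℕ} {G : List (List (ℕ × Fin h))} {p : ℕ × Fin h}
    (hi : i ≤ p.1) : shift i p ∈ vertices (G.map (window i)) ↔ p ∈ G.flatten := by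
  rw [vertices_map_window]
  constructor
  · intro hp
    obtain ⟨q, hq, hqp⟩ := List.mem_map.1 hp
    simp only [List.mem_filter, decide_eq_true_eq] at hq
    exact (shift_inj hq.2 hi).1 hqp ▸ hq.1
  · exact fun hp => List.mem_map.2 ⟨p, List.mem_filter.2 ⟨hp, by simpa using hi⟩, rfl⟩

theorem arcs_map_window (i : ℕ) (G : List (List (ℕ × Fin h))) :
    arcs (G.map (window i)).flatten =
      ((arcs G).filter fun x => decide (i ≤ x.1.1) && decide (i ≤ x.2.1)).map
        (Prod.map (shift i) (shift i)) := by
  rw [flatten_map_window, arcs_map, arcs_flatMap_runs]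

theorem trim_map_window (i : ℕ) (G : List (List (ℕ × Fin h))) :
    trim (G.map (window i)) = G.map (window (i + 1)) := by
  have hsplit : ∀ Q : List (ℕ × Fin h),
      (Q.splitOnP fun p => p.1 == 0).filter (fun P => !P.isEmpty) =
        runs (fun p => !(p.1 == 0)) Q := fun Q => by simp [runs]
  have hshift : ((fun p : ℕ × Fin h => !(p.1 == 0)) ∘ shift i) = fun p => decide (i + 1 ≤ p.1) := by
    funext p
    rw [Bool.eq_iff_iff]
    simp only [shift, Function.comp_apply, Bool.not_eq_true', beq_eq_false_iff_ne, ne_eq,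
      decide_eq_true_eq]
    omega
  rw [trim, List.map_map]
  refine List.map_congr_left fun P _ => ?_
  simp only [Function.comp_apply, List.filter_flatMap, hsplit]
  rw [window, List.flatMap_map]
  simp only [runs_map, hshift]
  rw [← List.map_flatMap, flatMap_runs_runs (by simp; omega), List.map_map, window]
  refine List.map_congr_left fun Q _ => ?_
  simp [shift, Nat.sub_sub]

/-- The parts of the paths of `G` in the columns `≤ c`. -/
def restrict (c : ℕ) (G : List (List (ℕ × Fin h))) : List (List (ℕ × Fin h)) :=
  G.flatMap (runs fun p => decide (p.1 ≤ c))

theorem flatten_restrict (c : ℕ) (G : List (List (ℕ × Fin h))) :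
    (restrict c G).flatten = G.flatten.filter fun p => decide (p.1 ≤ c) :=
  flatten_flatMap_runs _ G

theorem arcs_restrict (c : ℕ) (G : List (List (ℕ × Fin h))) :
    arcs (restrict c G) =
      (arcs G).filter fun x => decide (x.1.1 ≤ c) && decide (x.2.1 ≤ c) :=
  arcs_flatMap_runs _ G

theorem edgeCount_restrict_le (i c : ℕ) (G : List (List (ℕ × Fin h))) :
    edgeCount ((restrict c G).map (window i)) ≤ edgeCount (G.map (window i)) := by
  rw [edgeCount_eq_length_arcs, edgeCount_eq_length_arcs, arcs_map_window, arcs_map_window,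
    arcs_restrict, List.length_map, List.length_map]
  exact (List.Sublist.filter _ List.filter_sublist).length_le

theorem getLast?_filter_eq_or_col_eq {i : ℕ} {P : List (ℕ × Fin h)} (hP : P.IsChain (grid h).Adj)
    {e e' : ℕ × Fin h} (he : e ∈ P.getLast?)
    (he' : e' ∈ (P.filter fun p => decide (i ≤ p.1)).getLast?) : e' = e ∨ e'.1 = i := by
  induction P with
  | nil => simp at he
  | cons a P ih =>
    cases P with
    | nil =>
      rw [List.filter_cons] at he'
      split at he' <;> simp_all
    | cons b P =>
      rw [List.isChain_cons_cons] at hP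
      rw [List.getLast?_cons_cons] at he
      have ih := ih hP.2 he
      rw [List.filter_cons] at he'
      split at he'
      case isFalse => exact ih he'
      case isTrue ha =>
        cases hf : (b :: P).filter fun p => decide (i ≤ p.1) with
        | cons x t =>
          rw [hf, List.getLast?_cons_cons, ← hf] at he'
          exact ih he'
        | nil =>
          rw [hf] at he'
          obtain rfl : a = e' := by simpa using he'
          have hb : ¬ i ≤ b.1 := by simpa using List.filter_eq_nil_iff.1 hf b (by simp)
          have hcol := col_le_of_adj hP.1
          simp only [decide_eq_true_eq] at ha
          right
          omega

/-- A walk may run from the end of `P` through the columns `> c` to the start of `Q`. -/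
def Linked (c : ℕ) (P Q : List (ℕ × Fin h)) : Prop :=
  (∀ e ∈ P.getLast?, e.1 = c) ∧ ∀ s ∈ Q.head?, s.1 = c

theorem isChain_linked_iff {c : ℕ} {G : List (List (ℕ × Fin h))} :
    G.IsChain (Linked c) ↔ (∀ P ∈ G.dropLast, ∀ e ∈ P.getLast?, e.1 = c) ∧
      ∀ P ∈ G.tail, ∀ s ∈ P.head?, s.1 = c :=
  isChain_and_iff (P := fun P : List (ℕ × Fin h) => ∀ e ∈ P.getLast?, e.1 = c)
    (Q := fun P => ∀ s ∈ P.head?, s.1 = c)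

/-- The maximal pieces, in the columns `≤ c`, of a self-avoiding walk from the top-left corner that
may still grow into a trapped one. -/
structure IsPartialWalk (c : ℕ) (G : List (List (ℕ × Fin h))) : Prop where
  ne_nil : ∀ P ∈ G, P ≠ []
  isChain : ∀ P ∈ G, P.IsChain (grid h).Adj
  nodup : G.flatten.Nodup
  le : ∀ p ∈ G.flatten, p.1 ≤ c
  corner : ∃ p ∈ G.flatten.head?, p.1 = 0 ∧ p.2.val + 1 = h
  link : G.IsChain (Linked c)
  two_le : ∀ P ∈ G.dropLast, 2 ≤ P.length
  trapped : ∀ e ∈ G.flatten.getLast?, (e.1 < c ∨ G.getLast? = some [e]) →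
    ∀ q, (grid h).Adj e q → q.1 ≤ c → q ∈ G.flatten
  exists_col : ∃ p ∈ G.flatten, p.1 = c

namespace IsPartialWalk

variable {c i w : ℕ} {G : List (List (ℕ × Fin h))} {P : List (ℕ × Fin h)}

theorem adj_of_mem_arcs (hG : IsPartialWalk c G) : ∀ x ∈ arcs G, (grid h).Adj x.1 x.2 :=
  forall_isChain_iff_forall_mem_arcs.1 hG.isChain

theorem exists_mem_col (hG : IsPartialWalk c G) (hP : P ∈ G) : ∃ p ∈ P, p.1 = c := by
  have hne := hG.ne_nil P hP
  have hlink := isChain_linked_iff.1 hG.link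
  obtain ⟨l, m, rfl⟩ := List.append_of_mem hP
  cases m with
  | nil =>
    cases l with
    | nil => simpa using hG.exists_col
    | cons Q l =>
      exact ⟨P.head hne, List.head_mem hne,
        hlink.2 P (by simp) _ (by simp [List.head?_eq_some_head hne])⟩
  | cons Q m =>
    exact ⟨P.getLast hne, List.getLast_mem hne,
      hlink.1 P (by simp) _ (by simp [List.getLast?_eq_some_getLast hne])⟩

theorem isFrame (hG : IsPartialWalk c G) (hi : i ≤ c) (hw : c < i + w) :
    IsFrame w (G.map (Strip.window i)) where
  segment_ne_nil := by
    intro S hS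
    obtain ⟨P, hP, rfl⟩ := List.mem_map.1 hS
    obtain ⟨p, hp, hpc⟩ := hG.exists_mem_col hP
    exact window_ne_nil hp (by omega)
  path_ne_nil := by
    intro S hS Q hQ
    obtain ⟨P, -, rfl⟩ := List.mem_map.1 hS
    obtain ⟨R, hR, rfl⟩ := List.mem_map.1 hQ
    simpa using ne_nil_of_mem_runs hR
  isChain := by
    suffices H : ∀ Q ∈ (G.map (Strip.window i)).flatten, Q.IsChain (grid h).Adj from
      fun S hS Q hQ => H Q (List.mem_flatten.2 ⟨S, hS, hQ⟩)
    rw [forall_isChain_iff_forall_mem_arcs, arcs_map_window]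
    intro x hx
    obtain ⟨y, hy, rfl⟩ := List.mem_map.1 hx
    simp only [List.mem_filter, Bool.and_eq_true, decide_eq_true_eq] at hy
    exact (adj_shift hy.2.1 hy.2.2).2 (hG.adj_of_mem_arcs y hy.1)
  nodup := by
    rw [vertices_map_window]
    refine (hG.nodup.filter _).map_on fun a ha b hb => ?_
    simp only [List.mem_filter, decide_eq_true_eq] at ha hb
    exact (shift_inj ha.2 hb.2).1
  window := by
    intro p hp
    rw [vertices_map_window] at hp
    obtain ⟨q, hq, rfl⟩ := List.mem_map.1 hp
    have hqc := hG.le q (List.mem_filter.1 hq).1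
    simp only [shift]
    omega

-- An edge of the walk outside the columns `≤ i + 1` lies in the columns `≥ i`.
theorem edgeCount_map_window (hG : IsPartialWalk (i + 2) G) :
    (arcs G).length + edgeCount ((restrict (i + 1) G).map (Strip.window i)) =
      (arcs (restrict (i + 1) G)).length + edgeCount (G.map (Strip.window i)) := by
  rw [edgeCount_eq_length_arcs, edgeCount_eq_length_arcs, arcs_map_window, arcs_map_window,
    arcs_restrict, List.length_map, List.length_map, List.filter_filter,
    ← length_add_length_filter_and]
  · simp only [Bool.and_comm]
  · intro x hx
    have hcol := col_le_of_adj (hG.adj_of_mem_arcs x hx)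
    simp only [Bool.and_eq_true, decide_eq_true_eq]
    omega

end IsPartialWalk

/-! ## Cutting off the last column of a walk -/

/-- A path through the columns `≤ c` together with points of column `c + 1` before and behind it;
the column `c` is a parameter of `Piece.Wf`. -/
structure Piece (h : ℕ) where
  pre : List (ℕ × Fin h)
  body : List (ℕ × Fin h)
  suf : List (ℕ × Fin h)

namespace Piece

variable {c i : ℕ} {b : Piece h}

/-- The whole path of a piece. -/
def path (b : Piece h) : List (ℕ × Fin h) := b.pre ++ (b.body ++ b.suf)

/-- The three parts of a piece lie in the right columns, and the body touches column `c` where it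
continues into column `c + 1`. -/
structure Wf (c : ℕ) (b : Piece h) : Prop where
  ne_nil : b.body ≠ []
  body_le : ∀ x ∈ b.body, x.1 ≤ c
  pre_eq : ∀ x ∈ b.pre, x.1 = c + 1
  suf_eq : ∀ x ∈ b.suf, x.1 = c + 1
  head_eq : b.pre ≠ [] → ∀ x ∈ b.body.head?, x.1 = c
  last_eq : b.suf ≠ [] → ∀ x ∈ b.body.getLast?, x.1 = c

theorem window_path (hb : b.Wf c) (hi : i ≤ c) :
    window i b.path =
      extendEnd (b.suf.map (shift i)) (extendStart (b.pre.map (shift i)) (window i b.body)) := by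
  have hruns : runs (fun p => decide (i ≤ p.1)) b.path =
      extendEnd b.suf (extendStart b.pre (runs (fun p => decide (i ≤ p.1)) b.body)) := by
    rw [path, ← List.append_assoc, runs_append_extendEnd, runs_append_extendStart hb.ne_nil]
    · exact fun x hx => decide_eq_true (by rw [hb.pre_eq x hx]; omega)
    · exact fun hne x hx => decide_eq_true (by rw [hb.head_eq hne x hx]; exact hi)
    · simp [hb.ne_nil]
    · exact fun x hx => decide_eq_true (by rw [hb.suf_eq x hx]; omega)
    · intro hne x hx
      rw [List.getLast?_append_of_ne_nil _ hb.ne_nil] at hx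
      exact decide_eq_true (by rw [hb.last_eq hne x hx]; exact hi)
  rw [window, hruns, map_extendEnd, map_extendStart, window]

theorem path_ne_nil (hb : b.Wf c) : b.path ≠ [] := by simp [path, hb.ne_nil]

theorem getLast?_path_of_suf_ne_nil (hs : b.suf ≠ []) : b.path.getLast? = b.suf.getLast? := by
  rw [path, ← List.append_assoc, List.getLast?_append_of_ne_nil _ hs]

theorem getLast?_path_of_suf_eq_nil (hb : b.Wf c) (hs : b.suf = []) :
    b.path.getLast? = b.body.getLast? := by
  rw [path, hs, List.append_nil, List.getLast?_append_of_ne_nil _ hb.ne_nil]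

theorem head?_path_of_pre_ne_nil (hp : b.pre ≠ []) : b.path.head? = b.pre.head? :=
  List.head?_append_of_ne_nil _ hp

theorem head?_path_of_pre_eq_nil (hb : b.Wf c) (hp : b.pre = []) :
    b.path.head? = b.body.head? := by
  rw [path, hp, List.nil_append, List.head?_append_of_ne_nil _ hb.ne_nil]

theorem linked_path {b' : Piece h} (hb : b.Wf c) (hb' : b'.Wf c) (hs : b.suf ≠ [])
    (hp : b'.pre ≠ []) : Linked (c + 1) b.path b'.path := by
  rw [Linked, getLast?_path_of_suf_ne_nil hs, head?_path_of_pre_ne_nil hp]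
  exact ⟨fun e he => hb.suf_eq e (List.mem_of_getLast? he),
    fun s hs => hb'.pre_eq s (List.mem_of_mem_head? hs)⟩

-- A body with a single point would leave and reach column `c + 1` in its own row.
theorem two_le_length_body (hb : b.Wf c) (hch : b.path.IsChain (grid h).Adj)
    (hnd : b.path.Nodup) (hpre : b.pre ≠ []) (hsuf : b.suf ≠ []) : 2 ≤ b.body.length := by
  obtain ⟨x, l, hx⟩ := List.exists_cons_of_ne_nil hb.ne_nil
  by_contra hlt
  obtain rfl : l = [] := by
    rw [hx, List.length_cons] at hlt
    exact List.length_eq_zero_iff.1 (by omega)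
  obtain ⟨pre, y, hy⟩ := (List.eq_nil_or_concat' b.pre).resolve_left hpre
  obtain ⟨z, suf, hz⟩ := List.exists_cons_of_ne_nil hsuf
  have hpath : b.path = pre ++ (y :: x :: z :: suf) := by simp [path, hx, hy, hz]
  rw [hpath] at hch hnd
  have hyxz := hch.right_of_append
  simp only [List.isChain_cons_cons] at hyxz
  have hxc := hb.body_le x (by simp [hx])
  have hyc := hb.pre_eq y (by simp [hy])
  have hzc := hb.suf_eq z (by simp [hz])
  have hrow : y.2 = z.2 :=
    (row_eq_of_adj hyxz.1 (by omega)).trans (row_eq_of_adj hyxz.2.1 (by omega))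
  obtain rfl : y = z := Prod.ext (hyc.trans hzc.symm) hrow
  simpa using hnd.of_append_right

end Piece

/-- `B` is the list of pieces into which the paths of `G` are cut inside column `c + 1`. -/
structure IsCut (c : ℕ) (G : List (List (ℕ × Fin h))) (B : List (Piece h)) : Prop where
  wf : ∀ b ∈ B, b.Wf c
  body : B.map Piece.body = restrict c G
  flatten : (B.map Piece.path).flatten = G.flatten
  link : B.IsChain fun b b' => b.suf ≠ [] ∧ b'.pre ≠ []

theorem restrict_singleton (c : ℕ) (Q : List (ℕ × Fin h)) :
    restrict c [Q] = runs (fun p => decide (p.1 ≤ c)) Q := List.append_nil _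

namespace IsCut

variable {c i : ℕ} {G G' : List (List (ℕ × Fin h))} {Q pre body suf : List (ℕ × Fin h)}
  {x y : ℕ × Fin h} {b : Piece h} {B B' : List (Piece h)}

theorem single (hx : x.1 ≤ c) (hQ : ∀ y ∈ Q, y.1 = c + 1) (hadj : (x :: Q).IsChain (grid h).Adj) :
    IsCut c [x :: Q] [⟨[], [x], Q⟩] where
  wf := by
    rw [List.forall_mem_singleton]
    refine ⟨by simp, by simpa using hx, by simp, hQ, by simp, fun hne z hz => ?_⟩
    obtain ⟨y, Q, rfl⟩ := List.exists_cons_of_ne_nil hne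
    obtain rfl : x = z := by simpa using hz
    have hcol := col_le_of_adj (List.isChain_cons_cons.1 hadj).1
    have hy := hQ y (by simp)
    omega
  body := by
    have hneg : ∀ y ∈ Q, decide (y.1 ≤ c) = false := fun y hy => by simp [hQ y hy]
    rw [restrict_singleton, ← List.singleton_append (x := x) (l := Q),
      runs_append (Or.inr fun y hy => hneg y (List.mem_of_mem_head? hy)),
      runs_singleton (p := fun p : ℕ × Fin h => decide (p.1 ≤ c)) (decide_eq_true hx),
      runs_eq_nil hneg]
    rfl
  flatten := by simp [Piece.path]
  link := by simp

theorem cons_pre (hB : IsCut c [Q] (⟨pre, body, suf⟩ :: B)) (hx : x.1 = c + 1)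
    (hadj : (x :: Q).IsChain (grid h).Adj) : IsCut c [x :: Q] (⟨x :: pre, body, suf⟩ :: B) where
  wf := by
    obtain ⟨⟨hne, hle, hpre, hsuf, hhead, hlast⟩, hwf⟩ := List.forall_mem_cons.1 hB.wf
    refine List.forall_mem_cons.2 ⟨⟨hne, hle, List.forall_mem_cons.2 ⟨hx, hpre⟩, hsuf,
      fun _ z hz => ?_, hlast⟩, hwf⟩
    cases pre with
    | cons y pre => exact hhead (by simp) z hz
    | nil =>
      obtain ⟨t, ht⟩ := List.head?_eq_some_iff.1 hz
      obtain rfl : z :: (t ++ suf ++ (B.map Piece.path).flatten) = Q := by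
        simpa [Piece.path, show body = z :: t from ht] using hB.flatten
      have hcol := col_le_of_adj (List.isChain_cons_cons.1 hadj).1
      have hz := hle z (List.mem_of_mem_head? hz)
      omega
  body := by
    rw [restrict_singleton, runs_cons_neg (by simp [hx]), ← restrict_singleton, ← hB.body]
    rfl
  flatten := by simpa [Piece.path] using hB.flatten
  link := by simpa [List.isChain_cons] using hB.link

theorem cons_body (hB : IsCut c [Q] (⟨[], body, suf⟩ :: B)) (hx : x.1 ≤ c) :
    IsCut c [x :: Q] (⟨[], x :: body, suf⟩ :: B) := by
  obtain ⟨⟨hne, hle, hpre, hsuf, -, hlast⟩, hwf⟩ := List.forall_mem_cons.1 hB.wf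
  obtain ⟨z, body, rfl⟩ := List.exists_cons_of_ne_nil hne
  refine ⟨List.forall_mem_cons.2 ⟨⟨by simp, List.forall_mem_cons.2 ⟨hx, hle⟩, hpre, hsuf, by simp,
    hlast⟩, hwf⟩, ?_, by simpa [Piece.path] using hB.flatten,
    by simpa [List.isChain_cons] using hB.link⟩
  obtain rfl : z :: (body ++ suf ++ (B.map Piece.path).flatten) = Q := by
    simpa [Piece.path] using hB.flatten
  obtain ⟨t, R, hQ, hxQ⟩ := exists_runs_cons_cons (p := fun p : ℕ × Fin h => decide (p.1 ≤ c))
    (decide_eq_true hx) (decide_eq_true (hle z (by simp)))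
    (body ++ suf ++ (B.map Piece.path).flatten)
  have hbody := hB.body
  rw [restrict_singleton, hQ] at hbody
  rw [restrict_singleton, hxQ]
  simpa using hbody

theorem cons_new (hB : IsCut c [Q] (⟨y :: pre, body, suf⟩ :: B)) (hpre : pre ≠ []) (hx : x.1 ≤ c)
    (hadj : (x :: Q).IsChain (grid h).Adj) :
    IsCut c [x :: Q] (⟨[], [x], [y]⟩ :: ⟨pre, body, suf⟩ :: B) := by
  obtain ⟨⟨hne, hle, hpre', hsuf, hhead, hlast⟩, hwf⟩ := List.forall_mem_cons.1 hB.wf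
  obtain ⟨hy, hpre'⟩ := List.forall_mem_cons.1 hpre'
  obtain rfl : y :: (pre ++ (body ++ suf) ++ (B.map Piece.path).flatten) = Q := by
    simpa [Piece.path] using hB.flatten
  have hcol := col_le_of_adj (List.isChain_cons_cons.1 hadj).1
  refine ⟨List.forall_mem_cons.2 ⟨⟨by simp, by simpa using hx, by simp, by simpa using hy, by simp,
      fun _ z hz => ?_⟩, List.forall_mem_cons.2 ⟨⟨hne, hle, hpre', hsuf, fun _ => hhead (by simp),
      hlast⟩, hwf⟩⟩, ?_, by simp [Piece.path], ?_⟩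
  · obtain rfl : x = z := by simpa using hz
    omega
  · rw [restrict_singleton, runs_cons_cons_neg (p := fun p : ℕ × Fin h => decide (p.1 ≤ c))
        (decide_eq_true hx) (by simp [hy]),
      ← restrict_singleton, ← hB.body]
    rfl
  · refine List.isChain_cons_cons.2 ⟨⟨by simp, hpre⟩, ?_⟩
    simpa [List.isChain_cons] using hB.link

-- A single point of column `c + 1` between two points of the columns `≤ c` would repeat a point.
theorem pre_ne_nil_of_cons (hB : IsCut c [Q] (⟨y :: pre, body, suf⟩ :: B)) (hx : x.1 ≤ c)
    (hadj : (x :: Q).IsChain (grid h).Adj) (hnd : (x :: Q).Nodup) : pre ≠ [] := by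
  rintro rfl
  have hb := hB.wf _ (List.mem_cons_self ..)
  obtain ⟨z, body, rfl⟩ := List.exists_cons_of_ne_nil hb.ne_nil
  obtain rfl : y :: z :: (body ++ suf ++ (B.map Piece.path).flatten) = Q := by
    simpa [Piece.path] using hB.flatten
  simp only [List.isChain_cons_cons] at hadj
  have hy := hb.pre_eq y (by simp)
  have hz := hb.body_le z (by simp)
  simp [eq_mk_of_adj hadj.1.symm hy hx, eq_mk_of_adj hadj.2.1 hy hz] at hnd

theorem ne_nil (hB : IsCut c [Q] B) (hx : x ∈ Q) (hxc : x.1 ≤ c) : B ≠ [] := by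
  rintro rfl
  exact runs_ne_nil hx (p := fun p => decide (p.1 ≤ c)) (decide_eq_true hxc)
    (restrict_singleton c Q ▸ hB.body.symm)

theorem append (hB : IsCut c G B) (hB' : IsCut c G' B')
    (hlink : ∀ b ∈ B.getLast?, ∀ b' ∈ B'.head?, b.suf ≠ [] ∧ b'.pre ≠ []) :
    IsCut c (G ++ G') (B ++ B') where
  wf := List.forall_mem_append.2 ⟨hB.wf, hB'.wf⟩
  body := by rw [List.map_append, hB.body, hB'.body, restrict, restrict, restrict,
    List.flatMap_append]
  flatten := by rw [List.map_append, List.flatten_append, hB.flatten, hB'.flatten,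
    List.flatten_append]
  link := List.isChain_append.2 ⟨hB.link, hB'.link, hlink⟩

theorem pre_ne_nil_of_mem_tail (hB : IsCut c G B) : ∀ b ∈ B.tail, b.pre ≠ [] :=
  (isChain_and_iff.1 hB.link).2

theorem suf_ne_nil_of_mem_dropLast (hB : IsCut c G B) : ∀ b ∈ B.dropLast, b.suf ≠ [] :=
  (isChain_and_iff.1 hB.link).1

theorem getLast?_path (hB : IsCut c G B) (hb : b ∈ B.getLast?) :
    b.path.getLast? = G.flatten.getLast? := by
  have hne := Piece.path_ne_nil (hB.wf b (List.mem_of_getLast? hb))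
  obtain ⟨l, rfl⟩ := List.getLast?_eq_some_iff.1 hb
  rw [← hB.flatten, List.map_append, List.flatten_append, List.map_singleton,
    List.flatten_singleton, List.getLast?_append_of_ne_nil _ hne]

theorem head?_path (hB : IsCut c G B) (hb : b ∈ B.head?) : b.path.head? = G.flatten.head? := by
  have hne := Piece.path_ne_nil (hB.wf b (List.mem_of_mem_head? hb))
  obtain ⟨l, rfl⟩ := List.head?_eq_some_iff.1 hb
  rw [← hB.flatten, List.map_cons, List.flatten_cons, List.head?_append_of_ne_nil _ hne]

theorem suf_ne_nil (hB : IsCut c G B) (hG : ∀ e ∈ G.flatten.getLast?, e.1 = c + 1)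
    (hb : b ∈ B.getLast?) : b.suf ≠ [] := by
  intro hs
  have hw := hB.wf b (List.mem_of_getLast? hb)
  have hlast : b.body.getLast hw.ne_nil ∈ G.flatten.getLast? := by
    rw [← hB.getLast?_path hb, Piece.getLast?_path_of_suf_eq_nil hw hs]
    exact List.getLast?_eq_some_getLast hw.ne_nil
  have hcol := hG _ hlast
  have hle := hw.body_le _ (List.getLast_mem hw.ne_nil)
  omega

theorem pre_ne_nil (hB : IsCut c G B) (hG : ∀ s ∈ G.flatten.head?, s.1 = c + 1)
    (hb : b ∈ B.head?) : b.pre ≠ [] := by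
  intro hp
  have hw := hB.wf b (List.mem_of_mem_head? hb)
  have hhead : b.body.head hw.ne_nil ∈ G.flatten.head? := by
    rw [← hB.head?_path hb, Piece.head?_path_of_pre_eq_nil hw hp]
    exact List.head?_eq_some_head hw.ne_nil
  have hcol := hG _ hhead
  have hle := hw.body_le _ (List.head_mem hw.ne_nil)
  omega

theorem pre_eq_nil (hB : IsCut c G B) (hG : ∀ s ∈ G.flatten.head?, s.1 ≤ c)
    (hb : b ∈ B.head?) : b.pre = [] := by
  by_contra hp
  have hhead : b.pre.head hp ∈ G.flatten.head? := by
    rw [← hB.head?_path hb, Piece.head?_path_of_pre_ne_nil hp]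
    exact List.head?_eq_some_head hp
  have hle := hG _ hhead
  have hcol := (hB.wf b (List.mem_of_mem_head? hb)).pre_eq _ (List.head_mem hp)
  omega

end IsCut

theorem exists_isCut (c : ℕ) {Q : List (ℕ × Fin h)} (hadj : Q.IsChain (grid h).Adj)
    (hnd : Q.Nodup) (hle : ∀ x ∈ Q, x.1 ≤ c + 1) (hex : ∃ x ∈ Q, x.1 ≤ c) :
    ∃ B : List (Piece h), IsCut c [Q] B := by
  induction Q with
  | nil => simp at hex
  | cons x Q ih =>
    obtain ⟨hxle, hQle⟩ := List.forall_mem_cons.1 hle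
    by_cases hQ : ∃ y ∈ Q, y.1 ≤ c
    · obtain ⟨B, hB⟩ := ih hadj.tail hnd.tail hQle hQ
      obtain ⟨y, hy, hyc⟩ := hQ
      obtain ⟨⟨pre, body, suf⟩, B, rfl⟩ := List.exists_cons_of_ne_nil (hB.ne_nil hy hyc)
      by_cases hx : x.1 ≤ c
      · cases pre with
        | nil => exact ⟨_, hB.cons_body hx⟩
        | cons z pre => exact ⟨_, hB.cons_new (hB.pre_ne_nil_of_cons hx hadj hnd) hx hadj⟩
      · exact ⟨_, hB.cons_pre (by omega) hadj⟩
    · push Not at hQ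
      have hx : x.1 ≤ c := by
        by_contra hx
        obtain ⟨y, hy, hyc⟩ := hex
        rcases List.mem_cons.1 hy with rfl | hy
        · exact hx hyc
        · exact absurd (hQ y hy) (by omega)
      exact ⟨_, .single hx (fun y hy => le_antisymm (hQle y hy) (hQ y hy)) hadj⟩

theorem IsCut.infix_of_mem {c : ℕ} {Q : List (ℕ × Fin h)} {b : Piece h} {B : List (Piece h)}
    (hB : IsCut c [Q] B) (hb : b ∈ B) : b.path <:+: Q := by
  have hflat := hB.flatten
  rw [List.flatten_singleton] at hflat
  exact hflat ▸ List.infix_of_mem_flatten (List.mem_map_of_mem hb)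

theorem window_append {i : ℕ} {P Q : List (ℕ × Fin h)} (hP : P ≠ []) (hQ : Q ≠ [])
    (hl : ∀ e ∈ P.getLast?, i ≤ e.1) (hs : ∀ s ∈ Q.head?, i ≤ s.1) :
    window i (P ++ Q) = joinSegments (window i P) (window i Q) := by
  have hhead := List.head?_eq_some_head hQ
  rw [window, runs_append_joinSegments hP (by simpa using hl) hhead (by simpa using hs _ hhead),
    map_joinSegments]
  rfl

theorem merges_window {i c : ℕ} (hi : i ≤ c) {P : List (ℕ × Fin h)} {L : List (List (ℕ × Fin h))}
    (hL : ∀ Q ∈ P :: L, Q ≠ []) (hlink : (P :: L).IsChain (Linked c))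
    {M M' : List (Segment h)} (hM : Merges M M') :
    Merges ((P :: L).map (window i) ++ M) (window i (P :: L).flatten :: M') := by
  induction L generalizing P with
  | nil => simpa using Merges.keep hM
  | cons Q L ih =>
    obtain ⟨hP, hQ, hL⟩ : P ≠ [] ∧ Q ≠ [] ∧ ∀ R ∈ L, R ≠ [] := by
      simpa only [List.forall_mem_cons] using hL
    obtain ⟨hPQ, hlink⟩ := List.isChain_cons_cons.1 hlink
    refine Merges.join ?_
    rw [← window_append hP hQ (fun e he => hi.trans_eq (hPQ.1 e he).symm)
      fun s hs => hi.trans_eq (hPQ.2 s hs).symm]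
    have hPQL : ((P ++ Q) :: L).IsChain (Linked c) := by
      rw [List.isChain_cons] at hlink ⊢
      simpa only [Linked, List.getLast?_append_of_ne_nil _ hQ] using hlink
    simpa using ih (List.forall_mem_cons.2 ⟨by simp [hP], hL⟩) hPQL

theorem IsCut.isChain_linked {c : ℕ} {G : List (List (ℕ × Fin h))}
    {B : List (Piece h)} (hB : IsCut c G B) :
    (B.map Piece.path).IsChain (Linked (c + 1)) :=
  (List.isChain_map _).2 (hB.link.imp_of_mem_imp fun b b' hb hb' hbb' =>
    Piece.linked_path (hB.wf b hb) (hB.wf b' hb') hbb'.1 hbb'.2)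

theorem IsCut.merges {c i : ℕ} (hi : i ≤ c) {Q : List (ℕ × Fin h)} {b : Piece h}
    {B : List (Piece h)} (hB : IsCut c [Q] (b :: B)) {M M' : List (Segment h)} (hM : Merges M M') :
    Merges ((b :: B).map (fun b => window i b.path) ++ M) (window i Q :: M') := by
  have hne : ∀ P ∈ (b :: B).map Piece.path, P ≠ [] :=
    List.forall_mem_map.2 fun b' hb' => Piece.path_ne_nil (hB.wf b' hb')
  have hflat := hB.flatten
  rw [List.flatten_singleton, List.map_cons] at hflat
  simpa [← hflat, Function.comp_def]
    using merges_window (hi.trans c.le_succ) hne hB.isChain_linked hM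

theorem exists_isCut_of_linked {c : ℕ} {G : List (List (ℕ × Fin h))}
    (hadj : ∀ P ∈ G, P.IsChain (grid h).Adj) (hnd : G.flatten.Nodup)
    (hle : ∀ x ∈ G.flatten, x.1 ≤ c + 1) (hex : ∀ P ∈ G, ∃ x ∈ P, x.1 ≤ c)
    (hlink : G.IsChain (Linked (c + 1))) :
    ∃ B : List (Piece h), IsCut c G B ∧ (∀ b ∈ B, ∃ Q ∈ G, b.path <:+: Q) ∧
      ∀ i ≤ c, Merges (B.map fun b => window i b.path) (G.map (window i)) := by
  induction G with
  | nil => exact ⟨[], ⟨by simp, rfl, rfl, .nil⟩, by simp, fun i _ => .nil⟩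
  | cons Q G ih =>
    obtain ⟨hQadj, hGadj⟩ := List.forall_mem_cons.1 hadj
    obtain ⟨hQex, hGex⟩ := List.forall_mem_cons.1 hex
    obtain ⟨hQle, hGle⟩ := List.forall_mem_append.1 hle
    obtain ⟨B, hB, hBG, hBM⟩ := ih hGadj hnd.of_append_right hGle hGex hlink.tail
    obtain ⟨B', hB'⟩ := exists_isCut c hQadj hnd.of_append_left hQle hQex
    obtain ⟨x, hx, hxc⟩ := hQex
    obtain ⟨b, B', rfl⟩ := List.exists_cons_of_ne_nil (hB'.ne_nil hx hxc)
    refine ⟨_, hB'.append hB fun d hd d' hd' => ?_, fun d hd => ?_, fun i hi => ?_⟩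
    · obtain ⟨R, G, rfl⟩ : ∃ R G', G = R :: G' := by
        refine List.exists_cons_of_ne_nil ?_
        rintro rfl
        have hBnil := hB.body
        simp_all [restrict]
      have hQR := (List.isChain_cons_cons.1 hlink).1
      obtain ⟨y, hy, -⟩ := hGex R (by simp)
      exact ⟨hB'.suf_ne_nil (by simpa using hQR.1) hd,
        hB.pre_ne_nil (by simpa [List.head?_append_of_ne_nil _ (List.ne_nil_of_mem hy)]
          using hQR.2) hd'⟩
    · rcases List.mem_append.1 hd with hd | hd
      · exact ⟨Q, by simp, hB'.infix_of_mem hd⟩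
      · obtain ⟨R, hR, hdR⟩ := hBG d hd
        exact ⟨R, by simp [hR], hdR⟩
    · rw [List.map_append]
      exact hB'.merges hi (hBM i hi)

/-- The paths of `G` that reach the columns `≤ c`. -/
def reaching (c : ℕ) (G : List (List (ℕ × Fin h))) : List (List (ℕ × Fin h)) :=
  G.filter fun P => P.any fun p => decide (p.1 ≤ c)

theorem mem_reaching {c : ℕ} {G : List (List (ℕ × Fin h))} {P : List (ℕ × Fin h)} :
    P ∈ reaching c G ↔ P ∈ G ∧ ∃ p ∈ P, p.1 ≤ c := by
  simp [reaching]

theorem reaching_append (c : ℕ) (G G' : List (List (ℕ × Fin h))) :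
    reaching c (G ++ G') = reaching c G ++ reaching c G' := List.filter_append ..

theorem reaching_singleton {c : ℕ} {P : List (ℕ × Fin h)} (hP : ∃ p ∈ P, p.1 ≤ c) :
    reaching c [P] = [P] :=
  List.filter_eq_self.2 <| by simpa using hP

theorem reaching_eq_nil {c : ℕ} {G : List (List (ℕ × Fin h))} :
    reaching c G = [] ↔ ∀ P ∈ G, ∀ p ∈ P, c < p.1 := by
  simp [reaching, List.filter_eq_nil_iff]

theorem reaching_sublist (c : ℕ) (G : List (List (ℕ × Fin h))) : List.Sublist (reaching c G) G :=
  List.filter_sublist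

theorem restrict_reaching (c : ℕ) (G : List (List (ℕ × Fin h))) :
    restrict c (reaching c G) = restrict c G := by
  induction G with
  | nil => rfl
  | cons P G ih =>
    rw [← List.singleton_append, reaching_append]
    simp only [restrict, List.flatMap_append] at ih ⊢
    rw [ih]
    by_cases hP : ∃ p ∈ P, p.1 ≤ c
    · rw [reaching_singleton hP]
    · push Not at hP
      rw [reaching_eq_nil.2 (by simpa using hP), List.flatMap_nil, List.flatMap_singleton,
        runs_eq_nil (by simpa using hP)]

instance isTrans_linked (c : ℕ) : IsTrans (List (ℕ × Fin h)) (Linked c) :=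
  ⟨fun _ _ _ hPQ hQR => ⟨hPQ.1, hQR.2⟩⟩

theorem inserts_map_window {i : ℕ} {q : Prop} {T : List (List (ℕ × Fin h))}
    (hne : ∀ P ∈ T, P ≠ []) (hle : ∀ p ∈ T.flatten, p.1 ≤ i + 2)
    (htwo : ∀ P ∈ T.dropLast, 2 ≤ P.length)
    (hq : ∀ P ∈ T.getLast?, (∀ p ∈ P, i + 1 < p.1) → q) :
    Inserts q ((reaching (i + 1) T).map (window i)) (T.map (window i)) := by
  induction T with
  | nil => exact .nil
  | cons Q T ih =>
    obtain ⟨hQne, hTne⟩ := List.forall_mem_cons.1 hne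
    obtain ⟨hQle, hTle⟩ := List.forall_mem_append.1 hle
    have ih := ih hTne hTle (fun P hP => htwo P (by cases T <;> simp_all))
      fun P hP => hq P (by cases T <;> simp_all)
    rw [← List.singleton_append, reaching_append]
    by_cases hQ : ∃ p ∈ Q, p.1 ≤ i + 1
    · rw [reaching_singleton hQ]
      exact .old ih
    · push Not at hQ
      rw [reaching_eq_nil.2 (by simpa using hQ), List.nil_append, List.singleton_append,
        List.map_cons, window_eq_singleton hQne fun p hp => by have := hQ p hp; omega]
      refine .new (List.forall_mem_map.2 fun p hp => ?_) (fun hT => ?_) (fun hT => ?_) ih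
      · have hpQ := hQ p hp
        have hpQ' := hQle p hp
        simp only [shift]
        omega
      · rw [List.length_map]
        exact htwo Q (by cases T <;> simp_all)
      · rw [List.map_eq_nil_iff, reaching_eq_nil] at hT
        have hQT : ∀ P ∈ Q :: T, ∀ p ∈ P, i + 1 < p.1 := List.forall_mem_cons.2 ⟨hQ, hT⟩
        have hnil := List.cons_ne_nil Q T
        exact hq _ (List.getLast?_eq_some_getLast hnil) (hQT _ (List.getLast_mem hnil))

theorem exists_mem_col_eq {c : ℕ} {Q : List (ℕ × Fin h)} (hQ : Q.IsChain (grid h).Adj)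
    (hhead : ∀ s ∈ Q.head?, s.1 ≤ c) {p : ℕ × Fin h} (hp : p ∈ Q) (hpc : c ≤ p.1) :
    ∃ q ∈ Q, q.1 = c := by
  induction Q with
  | nil => simp at hp
  | cons a Q ih =>
    obtain hac | hac := (hhead a (by simp)).eq_or_lt
    · exact ⟨a, by simp, hac⟩
    · rw [List.isChain_cons] at hQ
      have hpQ : p ∈ Q := (List.mem_cons.1 hp).resolve_left (by rintro rfl; omega)
      obtain ⟨q, hq, hqc⟩ := ih hQ.2
        (fun s hs => (col_le_of_adj (hQ.1 s hs)).2.trans hac) hpQ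
      exact ⟨q, by simp [hq], hqc⟩

namespace IsPartialWalk

variable {c i : ℕ} {G : List (List (ℕ × Fin h))} {P : List (ℕ × Fin h)} {b : Piece h}
  {B : List (Piece h)}

theorem ne_nil_self (hG : IsPartialWalk c G) : G ≠ [] := by
  rintro rfl
  simpa using hG.exists_col

theorem isChain_linked_reaching (hG : IsPartialWalk c G) (c' : ℕ) :
    (reaching c' G).IsChain (Linked c) := hG.link.sublist (reaching_sublist c' G)

theorem exists_isCut_reaching (hG : IsPartialWalk (c + 1) G) :
    ∃ B : List (Piece h), IsCut c (reaching c G) B ∧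
      (∀ b ∈ B, b.path.IsChain (grid h).Adj ∧ b.path.Nodup) ∧
      ∀ i ≤ c, Merges (B.map fun b => window i b.path) ((reaching c G).map (window i)) := by
  have hsub := reaching_sublist c G
  obtain ⟨B, hB, hBG, hBM⟩ := exists_isCut_of_linked
    (fun P hP => hG.isChain P (hsub.subset hP)) (hG.nodup.sublist hsub.flatten)
    (fun p hp => hG.le p (hsub.flatten.subset hp)) (fun P hP => (mem_reaching.1 hP).2)
    (hG.isChain_linked_reaching c)
  refine ⟨B, hB, fun b hb => ?_, hBM⟩
  obtain ⟨Q, hQ, hbQ⟩ := hBG b hb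
  have hQG := hsub.subset hQ
  exact ⟨(hG.isChain Q hQG).infix hbQ,
    hG.nodup.sublist (hbQ.sublist.trans (List.sublist_flatten_of_mem hQG))⟩

theorem head_cons (hG : IsPartialWalk c G) :
    ∃ Q T, G = Q :: T ∧ ∃ p ∈ Q.head?, p.1 = 0 ∧ p.2.val + 1 = h := by
  obtain ⟨Q, T, rfl⟩ := List.exists_cons_of_ne_nil hG.ne_nil_self
  refine ⟨Q, T, rfl, ?_⟩
  simpa [List.head?_append_of_ne_nil _ (hG.ne_nil Q (by simp))] using hG.corner

theorem reaching_cons {Q : List (ℕ × Fin h)} {T : List (List (ℕ × Fin h))}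
    (hG : IsPartialWalk c (Q :: T)) (c' : ℕ) : reaching c' (Q :: T) = Q :: reaching c' T := by
  obtain ⟨_, _, hQT, p, hp, hp0, -⟩ := hG.head_cons
  obtain ⟨rfl, rfl⟩ := List.cons.inj hQT
  rw [← List.singleton_append, reaching_append,
    reaching_singleton ⟨p, List.mem_of_mem_head? hp, by omega⟩, List.singleton_append]

theorem pre_eq_nil (hG : IsPartialWalk (c + 1) G) (hB : IsCut c (reaching c G) B)
    (hb : b ∈ B.head?) : b.pre = [] := by
  obtain ⟨Q, T, rfl, p, hp, hp0, -⟩ := hG.head_cons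
  refine hB.pre_eq_nil (fun s hs => ?_) hb
  rw [hG.reaching_cons, List.flatten_cons,
    List.head?_append_of_ne_nil _ (hG.ne_nil Q (by simp))] at hs
  obtain rfl := Option.mem_unique hp hs
  omega

theorem suf_ne_nil (hG : IsPartialWalk (c + 1) G) (hB : IsCut c (reaching c G) B)
    (hP : P ∈ G.getLast?) (hPc : ∀ p ∈ P, c < p.1) (hb : b ∈ B.getLast?) : b.suf ≠ [] := by
  obtain ⟨G, rfl⟩ := List.getLast?_eq_some_iff.1 hP
  have hlast := (isChain_linked_iff.1 hG.link).1
  rw [List.dropLast_concat] at hlast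
  rw [reaching_append, reaching_eq_nil (G := [P]).2 (by simpa using hPc), List.append_nil] at hB
  refine hB.suf_ne_nil (fun e he => ?_) hb
  rcases List.eq_nil_or_concat' (reaching c G) with hnil | ⟨G', Q, hQ⟩
  · simp [hnil] at he
  · have hQG : Q ∈ G := (reaching_sublist c G).subset (by simp [hQ])
    rw [hQ, List.flatten_append, List.flatten_singleton,
      List.getLast?_append_of_ne_nil _ (hG.ne_nil Q (by simp [hQG]))] at he
    exact hlast Q hQG e he

theorem getLast?_body (hG : IsPartialWalk (c + 1) G) (hB : IsCut c (reaching c G) B)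
    (hb : b ∈ B.getLast?) (hs : b.suf = []) : b.body.getLast? = G.flatten.getLast? := by
  obtain ⟨G, P, rfl⟩ := (List.eq_nil_or_concat' G).resolve_left hG.ne_nil_self
  have hPc : ∃ p ∈ P, p.1 ≤ c := by
    by_contra! hPc
    exact hG.suf_ne_nil hB List.getLast?_concat hPc hb hs
  have hPne := hG.ne_nil P (by simp)
  rw [← Piece.getLast?_path_of_suf_eq_nil (hB.wf b (List.mem_of_getLast? hb)) hs,
    hB.getLast?_path hb, reaching_append, reaching_singleton hPc]
  simp only [List.flatten_append, List.flatten_singleton, List.getLast?_append_of_ne_nil _ hPne]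

theorem corner_restrict (hG : IsPartialWalk (c + 1) G) :
    ∃ p ∈ (restrict c G).flatten.head?, p.1 = 0 ∧ p.2.val + 1 = h := by
  obtain ⟨p, hp, hp0, hph⟩ := hG.corner
  obtain ⟨l, hl⟩ := List.head?_eq_some_iff.1 hp
  refine ⟨p, ?_, hp0, hph⟩
  rw [flatten_restrict, hl, List.filter_cons_of_pos (by simp [hp0])]
  rfl

theorem exists_col_restrict (hG : IsPartialWalk (c + 1) G) :
    ∃ p ∈ (restrict c G).flatten, p.1 = c := by
  obtain ⟨Q, T, rfl, s, hs, hs0, -⟩ := hG.head_cons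
  have hhead : ∀ t ∈ Q.head?, t.1 ≤ c := fun t ht => by
    obtain rfl := Option.mem_unique hs ht
    omega
  obtain ⟨p, hp, hpc⟩ := hG.exists_mem_col (P := Q) (by simp)
  obtain ⟨q, hq, hqc⟩ := exists_mem_col_eq (hG.isChain Q (by simp)) hhead hp (by omega)
  refine ⟨q, ?_, hqc⟩
  rw [flatten_restrict, List.mem_filter]
  exact ⟨by simp [hq], by simp [hqc]⟩

-- The first body joins column `0` to column `c`, the others both enter and leave column `c + 1`.
theorem two_le_length_body (hG : IsPartialWalk (c + 1) G) (hc : 0 < c)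
    (hB : IsCut c (reaching c G) B) (hadj : b.path.IsChain (grid h).Adj) (hnd : b.path.Nodup)
    (hb : b ∈ B) (hs : b.suf ≠ []) : 2 ≤ b.body.length := by
  have hw := hB.wf b hb
  by_cases hp : b.pre = []
  · obtain ⟨b', B, rfl⟩ := List.exists_cons_of_ne_nil (List.ne_nil_of_mem hb)
    obtain rfl : b = b' := (List.mem_cons.1 hb).resolve_right fun hmem =>
      hB.pre_ne_nil_of_mem_tail b hmem hp
    obtain ⟨p, hpG, hp0, -⟩ := hG.corner_restrict
    rw [← restrict_reaching, ← hB.body, List.map_cons, List.flatten_cons,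
      List.head?_append_of_ne_nil _ hw.ne_nil] at hpG
    obtain ⟨l, hl⟩ := List.head?_eq_some_iff.1 hpG
    cases l with
    | nil =>
      have hpc := hw.last_eq hs p (by simp [hl])
      omega
    | cons y l => simp [hl]
  · exact Piece.two_le_length_body hw hadj hnd hp hs

theorem trapped_restrict (hG : IsPartialWalk (c + 1) G) (hB : IsCut c (reaching c G) B)
    (htwo : ∀ b ∈ B, b.suf ≠ [] → 2 ≤ b.body.length) {e : ℕ × Fin h}
    (he : e ∈ (restrict c G).flatten.getLast?)
    (hcond : e.1 < c ∨ (restrict c G).getLast? = some [e]) {q : ℕ × Fin h}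
    (hq : (grid h).Adj e q) (hqc : q.1 ≤ c) : q ∈ (restrict c G).flatten := by
  rw [← restrict_reaching, ← hB.body] at he hcond
  obtain ⟨B, b, rfl⟩ : ∃ B' b, B = B' ++ [b] :=
    (List.eq_nil_or_concat' B).resolve_left (by rintro rfl; simp at he)
  have hw := hB.wf b (by simp)
  rw [List.map_append, List.map_singleton] at he hcond
  rw [List.flatten_append, List.flatten_singleton,
    List.getLast?_append_of_ne_nil _ hw.ne_nil] at he
  rw [List.getLast?_concat] at hcond
  have hs : b.suf = [] := by
    by_contra hs
    have hec := hw.last_eq hs e he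
    have hlen := htwo b (by simp) hs
    have hbe := Option.some.inj (hcond.resolve_left (by omega))
    simp [hbe] at hlen
  have hec := hw.body_le e (List.mem_of_getLast? he)
  rw [hG.getLast?_body hB List.getLast?_concat hs] at he
  rw [flatten_restrict, List.mem_filter]
  exact ⟨hG.trapped e he (.inl (by omega)) q hq (by omega), by simpa using hqc⟩

theorem restrict (hG : IsPartialWalk (c + 1) G) (hc : 0 < c) :
    IsPartialWalk c (Strip.restrict c G) := by
  obtain ⟨B, hB, hpath, -⟩ := hG.exists_isCut_reaching
  have htwo : ∀ b ∈ B, b.suf ≠ [] → 2 ≤ b.body.length := fun b hb =>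
    hG.two_le_length_body hc hB (hpath b hb).1 (hpath b hb).2 hb
  have hbody : B.map Piece.body = Strip.restrict c G := hB.body.trans (restrict_reaching c G)
  refine ⟨?_, ?_, ?_, ?_, hG.corner_restrict, ?_, ?_,
    fun e he hcond q hq hqc => hG.trapped_restrict hB htwo he hcond hq hqc, hG.exists_col_restrict⟩
  · intro P hP
    obtain ⟨Q, -, hP⟩ := List.mem_flatMap.1 hP
    exact ne_nil_of_mem_runs hP
  · rw [forall_isChain_iff_forall_mem_arcs, arcs_restrict]
    exact fun x hx => hG.adj_of_mem_arcs x (List.mem_filter.1 hx).1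
  · rw [flatten_restrict]
    exact hG.nodup.filter _
  · rw [flatten_restrict]
    exact fun p hp => by simpa using (List.mem_filter.1 hp).2
  · rw [← hbody, List.isChain_map]
    exact hB.link.imp_of_mem_imp fun x y hx hy hxy =>
      ⟨(hB.wf x hx).last_eq hxy.1, (hB.wf y hy).head_eq hxy.2⟩
  · rw [← hbody, ← List.map_dropLast]
    exact List.forall_mem_map.2 fun b hb =>
      htwo b (List.dropLast_subset _ hb) (hB.suf_ne_nil_of_mem_dropLast b hb)

end IsPartialWalk

theorem startsIn_window {i k : ℕ} {P : List (ℕ × Fin h)} (hP : P ≠ [])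
    (hs : ∀ s ∈ P.head?, s.1 = i + k) : StartsIn k (window i P) := by
  obtain ⟨a, P, rfl⟩ := List.exists_cons_of_ne_nil hP
  have ha := hs a (by simp)
  refine ⟨shift i a, ?_, by simp [shift, ha]⟩
  rw [flatten_window, List.filter_cons_of_pos (by simp [ha])]
  rfl

theorem endsIn_window {i k : ℕ} {P : List (ℕ × Fin h)} (hP : P ≠ [])
    (he : ∀ e ∈ P.getLast?, e.1 = i + k) : EndsIn k (window i P) := by
  obtain ⟨P, a, rfl⟩ := (List.eq_nil_or_concat' P).resolve_left hP
  have ha := he a (by simp)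
  refine ⟨shift i a, ?_, by simp [shift, ha]⟩
  rw [flatten_window]
  simp [ha]

theorem eq_singleton_of_window_eq_singleton {i : ℕ} {P : List (ℕ × Fin h)} {e : ℕ × Fin h}
    (hP : P.IsChain (grid h).Adj) (he : e ∈ P.getLast?) (hi : i < e.1)
    (hw : window i P = [[shift i e]]) : P = [e] := by
  obtain ⟨P, rfl⟩ := List.getLast?_eq_some_iff.1 he
  rcases List.eq_nil_or_concat' P with rfl | ⟨P, x, rfl⟩
  · rfl
  · have hcol := col_le_of_adj ((List.isChain_append.1 hP).2.2 x (by simp) e (by simp))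
    have hlen := congrArg (fun S => S.flatten.length) hw
    rw [flatten_window, List.filter_append, List.filter_append,
      List.filter_cons_of_pos (a := x) (by simp; omega),
      List.filter_cons_of_pos (a := e) (by simp; omega)] at hlen
    simp at hlen

theorem isLengthening_of_isCut {i c : ℕ} (hc : c = i + 1) {G : List (List (ℕ × Fin h))}
    {B : List (Piece h)} (hB : IsCut c G B) (hpre : ∀ b ∈ B.head?, b.pre = []) :
    IsLengthening ((restrict c G).map (window i))
      (B.map fun b => (b.pre.map (shift i), b.suf.map (shift i))) where
  length_eq := by simp [← hB.body]
  column := by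
    simp only [List.forall_mem_map, ← List.map_append]
    intro b hb x hx
    have hxc : x.1 = c + 1 := (List.mem_append.1 hx).elim ((hB.wf b hb).pre_eq x)
      ((hB.wf b hb).suf_eq x)
    simp only [shift]
    omega
  first_start := by
    rw [List.head?_map]
    intro a ha
    obtain ⟨b, hb, rfl⟩ := Option.mem_map.1 ha
    simp [hpre b hb]
  starts := by
    rw [← List.map_tail]
    exact List.forall_mem_map.2 fun b hb => by simpa using hB.pre_ne_nil_of_mem_tail b hb
  ends := by
    rw [← List.map_dropLast]
    exact List.forall_mem_map.2 fun b hb => by simpa using hB.suf_ne_nil_of_mem_dropLast b hb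

theorem IsCut.zipWith_extend {c i : ℕ} (hi : i ≤ c) {G : List (List (ℕ × Fin h))}
    {B : List (Piece h)} (hB : IsCut c G B) :
    List.zipWith (fun (a : List (ℕ × Fin h) × List (ℕ × Fin h)) T =>
        extendEnd a.2 (extendStart a.1 T))
      (B.map fun b => (b.pre.map (shift i), b.suf.map (shift i))) ((restrict c G).map (window i)) =
        B.map fun b => window i b.path := by
  rw [← hB.body, List.map_map, List.zipWith_map, List.zipWith_self]
  exact List.map_congr_left fun b hb => (Piece.window_path (hB.wf b hb) hi).symm

namespace IsPartialWalk

variable {c i : ℕ} {G : List (List (ℕ × Fin h))} {P : List (ℕ × Fin h)} {e : ℕ × Fin h}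

theorem startsIn_of_mem_tail (hG : IsPartialWalk (i + c) G) :
    ∀ S ∈ (G.map (Strip.window i)).tail, StartsIn c S := by
  rw [← List.map_tail]
  exact List.forall_mem_map.2 fun P hP => startsIn_window (hG.ne_nil P (List.mem_of_mem_tail hP))
    ((isChain_linked_iff.1 hG.link).2 P hP)

theorem endsIn_of_mem_dropLast (hG : IsPartialWalk (i + c) G) :
    ∀ S ∈ (G.map (Strip.window i)).dropLast, EndsIn c S := by
  rw [← List.map_dropLast]
  exact List.forall_mem_map.2 fun P hP => endsIn_window
    (hG.ne_nil P (List.dropLast_subset _ hP)) ((isChain_linked_iff.1 hG.link).1 P hP)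

theorem isExtension (hG : IsPartialWalk (i + 2) G) {F : Frame h 2} {X : Frame h 3}
    (hF : F.1 = (Strip.restrict (i + 1) G).map (Strip.window i))
    (hX : X.1 = G.map (Strip.window i)) : IsExtension F X := by
  have hR := hG.restrict i.succ_pos
  obtain ⟨Q, T, rfl, -⟩ := hG.head_cons
  obtain ⟨B, hB, -, hM⟩ := hG.exists_isCut_reaching
  have hBne : B ≠ [] := by
    rintro rfl
    exact hR.ne_nil_self ((hB.body.trans (restrict_reaching _ _)).symm)
  have hM := hM i i.le_succ
  rw [hG.reaching_cons, List.map_cons] at hM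
  have hlen := isLengthening_of_isCut (i := i) rfl hB fun b hb => hG.pre_eq_nil hB hb
  have hzip := hB.zipWith_extend i.le_succ
  rw [restrict_reaching] at hlen hzip
  refine ⟨hF ▸ hR.startsIn_of_mem_tail, hF ▸ hR.endsIn_of_mem_dropLast, _, hF ▸ hlen, _, _, _,
    by rwa [hF, hzip], ?_, by rw [hX, List.map_cons]⟩
  refine inserts_map_window (fun P hP => hG.ne_nil P (by simp [hP]))
    (fun p hp => hG.le p (by simp only [List.flatten_cons, List.mem_append, hp, or_true]))
    (fun P hP => hG.two_le P (by cases T <;> simp_all)) fun P hP hPc => ?_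
  have hP' : P ∈ (Q :: T).getLast? := by cases T <;> simp_all
  have hlast := List.getLast?_eq_some_getLast hBne
  simpa [List.getLast?_map, hlast] using hG.suf_ne_nil hB hP' hPc hlast

theorem getLast?_flatten (hG : IsPartialWalk c G) (hP : P ∈ G.getLast?) :
    G.flatten.getLast? = P.getLast? := by
  have hne := hG.ne_nil P (List.mem_of_getLast? hP)
  obtain ⟨G, rfl⟩ := List.getLast?_eq_some_iff.1 hP
  rw [List.flatten_append, List.flatten_singleton, List.getLast?_append_of_ne_nil _ hne]

theorem trapped_map_window (hi : i < e.1)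
    (he : ∀ q, (grid h).Adj e q → q.1 ≤ i + c → q ∈ G.flatten) :
    Trapped (c + 1) (G.map (Strip.window i)) (shift i e) := by
  intro q hq hqc
  have hqi : shift i (q.1 + i, q.2) = q := by simp [shift]
  rw [← hqi, adj_shift hi.le (by simp)] at hq
  rw [← hqi]
  exact (shift_mem_vertices_map_window (by simp)).2 (he _ hq (by simp only; omega))

theorem isValidExtension (hG : IsPartialWalk (i + 2) G) {F : Frame h 2} {X : Frame h 3}
    (hF : F.1 = (Strip.restrict (i + 1) G).map (Strip.window i))
    (hX : X.1 = G.map (Strip.window i)) : IsValidExtension F X := by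
  refine ⟨hG.isExtension hF hX, ?_, fun S hS e' he' hcond => ?_⟩
  · obtain ⟨p, hp, hpc⟩ := hG.exists_col
    exact ⟨shift i p, hX ▸ (shift_mem_vertices_map_window (by omega)).2 hp, by simp [shift, hpc]⟩
  · rw [hX, List.getLast?_map, Option.mem_map] at hS
    obtain ⟨P, hP, rfl⟩ := hS
    have hPmem := List.mem_of_getLast? hP
    have hPadj := hG.isChain P hPmem
    have hlast := List.getLast?_eq_some_getLast (hG.ne_nil P hPmem)
    rw [flatten_window, List.getLast?_map, Option.mem_map] at he'
    obtain ⟨e, he, rfl⟩ := he'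
    simp only [shift] at hcond
    obtain rfl : e = P.getLast (hG.ne_nil P hPmem) :=
      (getLast?_filter_eq_or_col_eq hPadj hlast he).resolve_right (by omega)
    refine hX ▸ trapped_map_window (by omega)
      (hG.trapped _ (hG.getLast?_flatten hP ▸ hlast) (hcond.imp (by omega) fun hS => ?_))
    rw [Option.mem_def.1 hP,
      ← eq_singleton_of_window_eq_singleton hPadj hlast (by omega) hS.2]

end IsPartialWalk

end PartialWalks

/-! ## Lifting an extension of a frame to a walk -/

section Lifting

variable {h i c : ℕ} {S T : Segment h} {P Q R suf pre : List (ℕ × Fin h)}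
  {G L N : List (List (ℕ × Fin h))}

theorem arcs_subset_arcs_joinSegments_left (S T : Segment h) :
    arcs S ⊆ arcs (joinSegments S T) := by
  fun_induction joinSegments S T with
  | case1 => simp
  | case2 => exact List.Subset.refl _
  | case3 P Q T =>
    rw [arcs_cons, arcs_cons, arcs_nil, List.append_nil]
    exact List.subset_append_of_subset_left _ fun x =>
      mem_consecutivePairs_of_infix (List.prefix_append P Q).isInfix
  | case4 P P' S T ih =>
    intro x hx
    rw [arcs_cons, List.mem_append] at hx ⊢
    exact hx.imp_right (@ih x)

theorem arcs_subset_arcs_joinSegments_right (S T : Segment h) :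
    arcs T ⊆ arcs (joinSegments S T) := by
  fun_induction joinSegments S T with
  | case1 => exact List.Subset.refl _
  | case2 => simp
  | case3 P Q T =>
    intro x hx
    simp only [arcs_cons, List.mem_append] at hx ⊢
    exact hx.imp_left (mem_consecutivePairs_of_infix (List.suffix_append P Q).isInfix)
  | case4 P P' S T ih =>
    rw [arcs_cons]
    exact List.subset_append_of_subset_right _ ih

theorem Merges.arcs_subset {L M : List (Segment h)} (hM : Merges L M) :
    arcs L.flatten ⊆ arcs M.flatten := by
  induction hM with
  | nil => exact List.Subset.refl _
  | keep _ ih =>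
    intro x hx
    simp only [List.flatten_cons, arcs_append, List.mem_append] at hx ⊢
    exact hx.imp_right (@ih x)
  | @join S T L M _ ih =>
    refine List.Subset.trans (fun x hx => ?_) ih
    simp only [List.flatten_cons, arcs_append, List.mem_append] at hx ⊢
    rcases hx with hx | hx | hx
    · exact Or.inl (arcs_subset_arcs_joinSegments_left S T hx)
    · exact Or.inl (arcs_subset_arcs_joinSegments_right S T hx)
    · exact Or.inr hx

theorem Inserts.arcs_subset {q : Prop} {L X : List (Segment h)} (hI : Inserts q L X) :
    arcs L.flatten ⊆ arcs X.flatten := by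
  induction hI with
  | nil => exact List.Subset.refl _
  | old _ ih =>
    intro x hx
    simp only [List.flatten_cons, arcs_append, List.mem_append] at hx ⊢
    exact hx.imp_right (@ih x)
  | new _ _ _ _ ih =>
    rw [List.flatten_cons, arcs_append]
    exact List.subset_append_of_subset_right _ ih

theorem mk_mem_arcs_extendEnd {a b : ℕ × Fin h} (hS : [] ∉ S) (ha : a ∈ S.flatten.getLast?)
    (hb : b ∈ suf.head?) : (a, b) ∈ arcs (extendEnd suf S) := by
  fun_induction extendEnd suf S with
  | case1 => simp at ha
  | case2 P => simpa using mk_mem_consecutivePairs_append (by simpa using ha) hb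
  | case3 P P' S ih =>
    simp only [List.mem_cons, not_or] at hS
    rw [arcs_cons, List.mem_append]
    refine Or.inr (ih (by simpa using hS.2) ?_)
    rwa [List.flatten_cons, List.getLast?_append_of_ne_nil] at ha
    simp [Ne.symm hS.2.1]

theorem nil_notMem_window (i : ℕ) (P : List (ℕ × Fin h)) : [] ∉ window i P := fun hmem => by
  obtain ⟨R, hR, hR'⟩ := List.mem_map.1 hmem
  exact ne_nil_of_mem_runs hR (List.map_eq_nil_iff.1 hR')

-- An edge from `window i P` into the new column leaves column `i + 1`, so it continues `P` itself.
theorem getLast?_col_eq_of_adj_extendEnd (hP : P.IsChain (grid h).Adj)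
    (hle : ∀ x ∈ P, x.1 ≤ i + 1) (hcol : ∃ x ∈ P, x.1 = i + 1) (hsuf : suf ≠ [])
    (hsufcol : ∀ x ∈ suf, x.1 = 2)
    (hadj : ∀ x ∈ arcs (extendEnd suf (extendStart pre (window i P))), (grid h).Adj x.1 x.2) :
    ∀ e ∈ P.getLast?, e.1 = i + 1 := by
  intro e he
  obtain ⟨x, hx, hxc⟩ := hcol
  have hne : (P.filter fun p => decide (i ≤ p.1)) ≠ [] :=
    List.ne_nil_of_mem (List.mem_filter.2 ⟨hx, by simp [hxc]⟩)
  have hlast := List.getLast?_eq_some_getLast hne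
  generalize (P.filter fun p => decide (i ≤ p.1)).getLast hne = e' at hlast
  have hwin : shift i e' ∈ (window i P).flatten.getLast? := by
    simp [flatten_window, List.getLast?_map, hlast]
  have hnil := nil_notMem_window i P
  obtain ⟨R, W, hW⟩ := List.exists_cons_of_ne_nil (window_ne_nil (i := i) hx (by omega))
  rw [hW] at hadj hwin hnil
  rw [List.mem_cons, not_or] at hnil
  have hstep := hadj _ (mk_mem_arcs_extendEnd (S := extendStart pre (R :: W)) (a := shift i e')
    (by simp [extendStart, hnil.2, Ne.symm hnil.1])
    (by
      rw [extendStart, List.flatten_cons, List.append_assoc, ← List.flatten_cons,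
        List.getLast?_append_of_ne_nil _ (by simp [Ne.symm hnil.1])]
      exact hwin)
    (List.head?_eq_some_head hsuf))
  have hhead := hsufcol _ (List.head_mem hsuf)
  have hstep := (col_le_of_adj hstep).2
  have he'le := hle e' (List.mem_of_mem_filter (List.mem_of_getLast? hlast))
  simp only [shift] at hstep
  rcases getLast?_filter_eq_or_col_eq hP he hlast with rfl | hcol <;> omega

theorem exists_map_shift_eq {k : ℕ} (i : ℕ) {l : List (ℕ × Fin h)} (hl : ∀ p ∈ l, p.1 = k) :
    ∃ l' : List (ℕ × Fin h), l'.map (shift i) = l ∧ ∀ x ∈ l', x.1 = i + k :=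
  ⟨l.map fun p => (i + p.1, p.2), by simp [shift, Function.comp_def],
    List.forall_mem_map.2 fun p hp => by simp [hl p hp]⟩

theorem exists_pieces {A : List (List (ℕ × Fin h) × List (ℕ × Fin h))} (i : ℕ)
    (hlen : A.length = G.length) (hcol : ∀ a ∈ A, ∀ p ∈ a.1 ++ a.2, p.1 = 2) :
    ∃ B : List (Piece h), B.map Piece.body = G ∧
      B.map (fun b => (b.pre.map (shift i), b.suf.map (shift i))) = A ∧
      ∀ b ∈ B, (∀ x ∈ b.pre, x.1 = i + 2) ∧ ∀ x ∈ b.suf, x.1 = i + 2 := by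
  induction A generalizing G with
  | nil =>
    obtain rfl := List.length_eq_zero_iff.1 hlen.symm
    exact ⟨[], by simp⟩
  | cons a A ih =>
    obtain ⟨P, G, rfl⟩ := List.exists_cons_of_length_pos
      (by rw [← hlen]; exact Nat.succ_pos _ : 0 < G.length)
    simp only [List.forall_mem_cons, List.forall_mem_append] at hcol
    obtain ⟨B, rfl, rfl, hB⟩ := ih (Nat.succ.inj hlen) (by simpa only [List.forall_mem_append]
      using hcol.2)
    obtain ⟨pre, hpre, hprecol⟩ := exists_map_shift_eq i hcol.1.1
    obtain ⟨suf, hsuf, hsufcol⟩ := exists_map_shift_eq i hcol.1.2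
    exact ⟨⟨pre, P, suf⟩ :: B, by simp, by simp [hpre, hsuf],
      List.forall_mem_cons.2 ⟨⟨hprecol, hsufcol⟩, hB⟩⟩

theorem Piece.runs_path {b : Piece h} (hb : b.Wf c) :
    runs (fun p => decide (p.1 ≤ c)) b.path = [b.body] := by
  have hpre : ∀ x ∈ b.pre, decide (x.1 ≤ c) = false := fun x hx => by simp [hb.pre_eq x hx]
  have hsuf : ∀ x ∈ b.suf, decide (x.1 ≤ c) = false := fun x hx => by simp [hb.suf_eq x hx]
  rw [path, runs_append (Or.inl fun a ha => hpre a (List.mem_of_getLast? ha)),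
    runs_append (Or.inr fun a ha => hsuf a (List.mem_of_mem_head? ha)), runs_eq_nil hpre,
    runs_eq_nil hsuf, runs_eq_singleton hb.ne_nil (by simpa using hb.body_le)]
  rfl

theorem isCut_map_path {B : List (Piece h)} (hwf : ∀ b ∈ B, b.Wf c)
    (hlink : B.IsChain fun b b' => b.suf ≠ [] ∧ b'.pre ≠ []) : IsCut c (B.map Piece.path) B where
  wf := hwf
  body := by
    rw [restrict, List.flatMap_map, List.flatMap_congr fun b hb => Piece.runs_path (hwf b hb),
      ← List.map_eq_flatMap]
  flatten := rfl
  link := hlink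

theorem IsPartialWalk.exists_isCut_of_isLengthening (hG : IsPartialWalk (i + 1) G)
    {A : List (List (ℕ × Fin h) × List (ℕ × Fin h))} (hA : IsLengthening (G.map (window i)) A)
    (hadj : ∀ x ∈ arcs (List.zipWith (fun a T => extendEnd a.2 (extendStart a.1 T)) A
      (G.map (window i))).flatten, (grid h).Adj x.1 x.2) :
    ∃ B : List (Piece h), IsCut (i + 1) (B.map Piece.path) B ∧ B.map Piece.body = G ∧
      B.map (fun b => (b.pre.map (shift i), b.suf.map (shift i))) = A ∧
      ∀ b ∈ B.head?, b.pre = [] := by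
  obtain ⟨B, rfl, rfl, hBcol⟩ := exists_pieces i (by simpa using hA.length_eq) hA.column
  have hfirst : ∀ b ∈ B.head?, b.pre = [] := fun b hb => by
    simpa using hA.first_start (b.pre.map (shift i), b.suf.map (shift i))
      (by rw [List.head?_map]; exact Option.mem_map_of_mem _ hb)
  have hstarts : ∀ b ∈ B.tail, b.pre ≠ [] := by
    simpa [← List.map_tail] using hA.starts
  have hends : ∀ b ∈ B.dropLast, b.suf ≠ [] := by
    simpa [← List.map_dropLast] using hA.ends
  refine ⟨B, isCut_map_path (fun b hb => ?_) (isChain_and_iff.2 ⟨hends, hstarts⟩), rfl, rfl, hfirst⟩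
  have hbG := List.mem_map_of_mem (f := Piece.body) hb
  have hle : ∀ x ∈ b.body, x.1 ≤ i + 1 := fun x hx => hG.le x (List.mem_flatten_of_mem hbG hx)
  refine ⟨hG.ne_nil _ hbG, hle, (hBcol b hb).1, (hBcol b hb).2, fun hpre => ?_, fun hsuf => ?_⟩
  · refine (isChain_linked_iff.1 hG.link).2 b.body ?_
    obtain ⟨b₀, B, rfl⟩ := List.exists_cons_of_ne_nil (List.ne_nil_of_mem hb)
    refine List.mem_map_of_mem ((List.mem_cons.1 hb).resolve_left ?_)
    rintro rfl
    exact hpre (hfirst b (by simp))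
  · refine getLast?_col_eq_of_adj_extendEnd (hG.isChain _ hbG) hle (hG.exists_mem_col hbG)
      (suf := b.suf.map (shift i)) (pre := b.pre.map (shift i)) (by simpa using hsuf)
      (List.forall_mem_map.2 fun x hx => by simp [shift, (hBcol b hb).2 x hx]) fun x hx => ?_
    obtain ⟨P, hP, hxP⟩ := mem_arcs.1 hx
    rw [List.map_map, List.zipWith_map, List.zipWith_self] at hadj
    exact hadj x (mem_arcs.2 ⟨P, List.mem_flatten_of_mem (List.mem_map_of_mem hb) hP, hxP⟩)

/-- No step of the path crosses the columns `i` and `i + 1` at once, so every step is visible in the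
columns `≤ i + 1` or in the columns `≥ i`. -/
def NoJump (i : ℕ) (P : List (ℕ × Fin h)) : Prop :=
  P.IsChain fun a b => (a.1 ≤ i + 1 ∧ b.1 ≤ i + 1) ∨ (i ≤ a.1 ∧ i ≤ b.1)

namespace NoJump

theorem of_le (hP : ∀ x ∈ P, x.1 ≤ i + 1) : NoJump i P :=
  isChain_iff_forall_mem_consecutivePairs.2 fun _ hx =>
    have hmem := mem_of_mem_consecutivePairs hx
    Or.inl ⟨hP _ hmem.1, hP _ hmem.2⟩

theorem of_ge (hP : ∀ x ∈ P, i ≤ x.1) : NoJump i P :=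
  isChain_iff_forall_mem_consecutivePairs.2 fun _ hx =>
    have hmem := mem_of_mem_consecutivePairs hx
    Or.inr ⟨hP _ hmem.1, hP _ hmem.2⟩

theorem append (hP : NoJump i P) (hQ : NoJump i Q)
    (hPQ : ∀ a ∈ P.getLast?, ∀ b ∈ Q.head?, i ≤ a.1 ∧ i ≤ b.1) : NoJump i (P ++ Q) :=
  List.isChain_append.2 ⟨hP, hQ, fun a ha b hb => Or.inr (hPQ a ha b hb)⟩

end NoJump

/-- A path that continues some path of the columns `≤ i + 1`, as opposed to a new path inside column
`i + 2`. -/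
structure IsOldPath (i : ℕ) (P : List (ℕ × Fin h)) : Prop where
  noJump : NoJump i P
  exists_le : ∃ x ∈ P, x.1 ≤ i + 1

namespace IsOldPath

theorem ne_nil (hP : IsOldPath i P) : P ≠ [] :=
  let ⟨_, hx, _⟩ := hP.exists_le
  List.ne_nil_of_mem hx

theorem nil_notMem (hG : ∀ P ∈ G, IsOldPath i P) : [] ∉ G :=
  fun h => (hG [] h).ne_nil rfl

theorem append (hP : IsOldPath i P) (hQ : IsOldPath i Q) (hPQ : Linked (i + 2) P Q) :
    IsOldPath i (P ++ Q) where
  noJump := hP.noJump.append hQ.noJump fun a ha b hb => by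
    rw [hPQ.1 a ha, hPQ.2 b hb]
    omega
  exists_le :=
    let ⟨x, hx, hxc⟩ := hP.exists_le
    ⟨x, List.mem_append_left _ hx, hxc⟩

theorem two_le_length (hP : IsOldPath i P) {k : ℕ} (hk : i + 1 < k)
    (hend : (∀ e ∈ P.getLast?, e.1 = k) ∨ ∀ s ∈ P.head?, s.1 = k) : 2 ≤ P.length := by
  obtain ⟨x, hx, hxc⟩ := hP.exists_le
  match P, hx with
  | [a], hx =>
    obtain rfl : x = a := by simpa using hx
    have : x.1 = k := by simpa using hend
    omega
  | _ :: _ :: _, _ => simp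

end IsOldPath

theorem Piece.isOldPath {b : Piece h} (hb : b.Wf (i + 1)) : IsOldPath i b.path := by
  refine ⟨?_, b.body.head hb.ne_nil, by simp [path], hb.body_le _ (List.head_mem _)⟩
  have hpre : ∀ x ∈ b.pre, i ≤ x.1 := fun x hx => by rw [hb.pre_eq x hx]; omega
  have hsuf : ∀ x ∈ b.suf, i ≤ x.1 := fun x hx => by rw [hb.suf_eq x hx]; omega
  refine (NoJump.of_ge hpre).append ((NoJump.of_le hb.body_le).append (.of_ge hsuf) ?_) ?_
  · intro x hx y hy
    have hy := List.mem_of_mem_head? hy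
    have hxcol := hb.last_eq (List.ne_nil_of_mem hy) x hx
    exact ⟨by omega, hsuf y hy⟩
  · intro x hx y hy
    have hx := List.mem_of_getLast? hx
    rw [List.head?_append_of_ne_nil _ hb.ne_nil] at hy
    have hycol := hb.head_eq (List.ne_nil_of_mem hx) y hy
    exact ⟨hpre x hx, by omega⟩

theorem isChain_linked_cons_iff (hG : [] ∉ G) :
    (P :: G).IsChain (Linked c) ↔
      G.IsChain (Linked c) ∧
        ∀ s ∈ G.flatten.head?, s.1 = c ∧ ∀ e ∈ P.getLast?, e.1 = c := by
  cases G with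
  | nil => simp
  | cons Q G =>
    have hQ : Q ≠ [] := fun hQ => hG (by simp [hQ])
    have hhead := List.head?_eq_some_head hQ
    rw [List.isChain_cons_cons, and_comm, List.flatten_cons, List.head?_append_of_ne_nil _ hQ,
      Linked, hhead]
    simp [and_comm]

theorem getLast?_eq_of_isChain_linked_cons (hlink : (P :: G).IsChain (Linked c))
    (hP : G = [] → ∀ e ∈ P.getLast?, e.1 = c) : ∀ e ∈ P.getLast?, e.1 = c := by
  cases G with
  | nil => exact hP rfl
  | cons Q G => exact (List.isChain_cons_cons.1 hlink).1.1

theorem restrict_append_cons (hP : ∀ e ∈ P.getLast?, c < e.1) :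
    restrict c ((P ++ Q) :: G) = restrict c (P :: Q :: G) := by
  simp only [restrict, List.flatMap_cons]
  rw [runs_append (Or.inl fun e he => by simpa using hP e he), List.append_assoc]

theorem restrict_cons_of_forall_lt (hP : ∀ x ∈ P, c < x.1) :
    restrict c (P :: G) = restrict c G := by
  rw [restrict, List.flatMap_cons, runs_eq_nil fun x hx => by simpa using hP x hx]
  rfl

theorem Merges.lift {M : List (Segment h)} (hM : Merges (L.map (window i)) M)
    (hL : ∀ P ∈ L, IsOldPath i P) (hlink : L.IsChain (Linked (i + 2))) :
    ∃ N : List (List (ℕ × Fin h)), M = N.map (window i) ∧ (∀ P ∈ N, IsOldPath i P) ∧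
      N.IsChain (Linked (i + 2)) ∧ N.flatten = L.flatten ∧
      restrict (i + 1) N = restrict (i + 1) L := by
  generalize hK : L.map (window i) = K at hM
  induction hM generalizing L with
  | nil =>
    obtain rfl := List.map_eq_nil_iff.1 hK
    exact ⟨[], by simp⟩
  | keep _ ih =>
    obtain ⟨P, L, rfl, rfl, rfl⟩ := List.map_eq_cons_iff.1 hK
    obtain ⟨hP, hL⟩ := List.forall_mem_cons.1 hL
    obtain ⟨N, rfl, hN, hNlink, hNflat, hNres⟩ := ih hL hlink.tail rfl
    rw [isChain_linked_cons_iff (IsOldPath.nil_notMem hL), ← hNflat] at hlink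
    exact ⟨P :: N, rfl, List.forall_mem_cons.2 ⟨hP, hN⟩,
      (isChain_linked_cons_iff (IsOldPath.nil_notMem hN)).2 ⟨hNlink, hlink.2⟩, by simp [hNflat],
      congrArg (_ ++ ·) hNres⟩
  | join _ ih =>
    obtain ⟨P, L', rfl, rfl, hK'⟩ := List.map_eq_cons_iff.1 hK
    obtain ⟨Q, L, rfl, rfl, rfl⟩ := List.map_eq_cons_iff.1 hK'
    simp only [List.forall_mem_cons] at hL
    obtain ⟨hP, hQ, hL⟩ := hL
    obtain ⟨hPQ, hlink⟩ := List.isChain_cons_cons.1 hlink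
    have hPQL : ((P ++ Q) :: L).IsChain (Linked (i + 2)) := by
      rw [isChain_linked_cons_iff (IsOldPath.nil_notMem hL)] at hlink ⊢
      rwa [List.getLast?_append_of_ne_nil _ hQ.ne_nil]
    have hwin := window_append (i := i) hP.ne_nil hQ.ne_nil
      (fun e he => by rw [hPQ.1 e he]; omega) fun s hs => by rw [hPQ.2 s hs]; omega
    obtain ⟨N, rfl, hN, hNlink, hNflat, hNres⟩ :=
      ih (L := (P ++ Q) :: L) (List.forall_mem_cons.2 ⟨hP.append hQ hPQ, hL⟩) hPQL
        (by rw [List.map_cons, hwin])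
    exact ⟨N, rfl, hN, hNlink, by simp [hNflat],
      hNres.trans (restrict_append_cons fun e he => by rw [hPQ.1 e he]; omega)⟩

theorem forall_mem_dropLast_cons {α : Type*} {p : α → Prop} {a : α} {l : List α}
    (ha : l ≠ [] → p a) (hl : ∀ x ∈ l.dropLast, p x) : ∀ x ∈ (a :: l).dropLast, p x := by
  cases l with
  | nil => simp
  | cons b l => exact List.forall_mem_cons.2 ⟨ha (by simp), hl⟩

theorem Inserts.lift {q : Prop} {X : List (Segment h)} (hI : Inserts q (N.map (window i)) X)
    (hX : ∀ S ∈ X, [] ∉ S) (hN : ∀ P ∈ N, IsOldPath i P)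
    (hlink : (Q :: N).IsChain (Linked (i + 2)))
    (hq : q → ∀ e ∈ (Q :: N).flatten.getLast?, e.1 = i + 2) :
    ∃ Y : List (List (ℕ × Fin h)), X = Y.map (window i) ∧ (∀ P ∈ Y, P ≠ [] ∧ NoJump i P) ∧
      (Q :: Y).IsChain (Linked (i + 2)) ∧ (∀ P ∈ Y.dropLast, 2 ≤ P.length) ∧
      restrict (i + 1) Y = restrict (i + 1) N := by
  generalize hL : N.map (window i) = L at hI
  induction hI generalizing N Q with
  | nil =>
    obtain rfl := List.map_eq_nil_iff.1 hL
    exact ⟨[], by simp⟩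
  | old _ ih =>
    obtain ⟨P, N, rfl, rfl, rfl⟩ := List.map_eq_cons_iff.1 hL
    obtain ⟨hP, hN⟩ := List.forall_mem_cons.1 hN
    obtain ⟨hQP, hlink⟩ := List.isChain_cons_cons.1 hlink
    rw [List.flatten_cons, List.getLast?_append_of_ne_nil _ (by simp [hP.ne_nil])] at hq
    obtain ⟨Y, rfl, hY, hYlink, hYtwo, hYres⟩ :=
      ih (List.forall_mem_cons.1 hX).2 hN hlink hq rfl
    exact ⟨P :: Y, rfl, List.forall_mem_cons.2 ⟨⟨hP.ne_nil, hP.noJump⟩, hY⟩,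
      List.isChain_cons_cons.2 ⟨hQP, hYlink⟩,
      forall_mem_dropLast_cons (fun _ => hP.two_le_length (by omega) (.inr hQP.2)) hYtwo,
      congrArg (_ ++ ·) hYres⟩
  | @new P L X hcol htwo hqL _ ih =>
    obtain ⟨P, rfl, hP⟩ := exists_map_shift_eq i hcol
    have hPne : P ≠ [] := by rintro rfl; simp at hX
    have hPge : ∀ x ∈ P, i ≤ x.1 := fun x hx => by rw [hP x hx]; omega
    have hPend : ∀ e ∈ P.getLast?, e.1 = i + 2 := fun e he => hP e (List.mem_of_getLast? he)
    have hPstart : ∀ s ∈ P.head?, s.1 = i + 2 := fun s hs => hP s (List.mem_of_mem_head? hs)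
    have hQend := getLast?_eq_of_isChain_linked_cons hlink fun hN => by
      subst hN
      simpa using hq (hqL hL.symm)
    rw [isChain_linked_cons_iff (IsOldPath.nil_notMem hN)] at hlink
    obtain ⟨Y, rfl, hY, hYlink, hYtwo, hYres⟩ := ih (List.forall_mem_cons.1 hX).2 (Q := P) hN
      ((isChain_linked_cons_iff (IsOldPath.nil_notMem hN)).2
        ⟨hlink.1, fun s hs => ⟨(hlink.2 s hs).1, hPend⟩⟩)
      (fun hq' e he => by
        rw [List.flatten_cons, List.getLast?_append] at he hq
        cases hlast : N.flatten.getLast? with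
        | none => exact hPend e (by simpa [hlast] using he)
        | some e' => exact hq hq' e (by simpa [hlast] using he))
      hL
    exact ⟨P :: Y, by rw [List.map_cons, window_eq_singleton hPne hPge],
      List.forall_mem_cons.2 ⟨⟨hPne, .of_ge hPge⟩, hY⟩,
      List.isChain_cons_cons.2 ⟨⟨hQend, hPstart⟩, hYlink⟩,
      forall_mem_dropLast_cons (fun hYne => by simpa using htwo (by simpa using hYne)) hYtwo,
      (restrict_cons_of_forall_lt fun x hx => by rw [hP x hx]; omega).trans hYres⟩

end Lifting

section Extension

variable {h i c w : ℕ} {G Y : List (List (ℕ × Fin h))} {P Q : List (ℕ × Fin h)} {e : ℕ × Fin h}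

theorem IsFrame.adj_of_mem_arcs {F : List (Segment h)} (hF : IsFrame w F) :
    ∀ x ∈ arcs F.flatten, (grid h).Adj x.1 x.2 :=
  forall_isChain_iff_forall_mem_arcs.1 fun P hP =>
    let ⟨S, hS, hPS⟩ := List.mem_flatten.1 hP
    hF.isChain S hS P hPS

theorem adj_of_merges_of_inserts {X : Frame h 3} {S : Segment h} {L L' X' : List (Segment h)}
    {q : Prop} (hM : Merges L (S :: L')) (hI : Inserts q L' X') (hX : X.1 = S :: X') :
    ∀ x ∈ arcs L.flatten, (grid h).Adj x.1 x.2 := by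
  intro x hx
  refine X.2.adj_of_mem_arcs x ?_
  have hx := hM.arcs_subset hx
  rw [List.flatten_cons, arcs_append, List.mem_append] at hx
  rw [hX, List.flatten_cons, arcs_append, List.mem_append]
  exact hx.imp_right fun hx => hI.arcs_subset hx

theorem IsCut.head?_flatten_map_body {B : List (Piece h)} (hB : IsCut c G B)
    (hfirst : ∀ b ∈ B.head?, b.pre = []) :
    (B.map Piece.body).flatten.head? = G.flatten.head? := by
  cases B with
  | nil => rw [← hB.flatten]; rfl
  | cons b B =>
    have hb := hB.wf b (by simp)
    rw [← hB.head?_path rfl, Piece.head?_path_of_pre_eq_nil hb (hfirst b rfl), List.map_cons,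
      List.flatten_cons, List.head?_append_of_ne_nil _ hb.ne_nil]

theorem IsPartialWalk.exists_lift (hG : IsPartialWalk (i + 1) G) {F : Frame h 2} {X : Frame h 3}
    (hF : F.1 = G.map (window i)) (hX : IsExtension F X) :
    ∃ Y : List (List (ℕ × Fin h)), X.1 = Y.map (window i) ∧ Strip.restrict (i + 1) Y = G ∧
      (∀ P ∈ Y, P ≠ [] ∧ NoJump i P) ∧ Y.IsChain (Linked (i + 2)) ∧
      (∀ P ∈ Y.dropLast, 2 ≤ P.length) ∧ Y.flatten.head? = G.flatten.head? := by
  obtain ⟨-, -, A, hA, S, L, X', hM, hI, hXS⟩ := hX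
  rw [hF] at hA hM
  obtain ⟨B, hB, hBG, rfl, hfirst⟩ :=
    hG.exists_isCut_of_isLengthening hA (adj_of_merges_of_inserts hM hI hXS)
  have hres : Strip.restrict (i + 1) (B.map Piece.path) = G := hB.body.symm.trans hBG
  have hzip := hB.zipWith_extend i.le_succ
  rw [hres] at hzip
  rw [hzip, ← Function.comp_def (window i), ← List.map_map] at hM
  obtain ⟨N, hN, hNold, hNlink, hNflat, hNres⟩ :=
    hM.lift (List.forall_mem_map.2 fun b hb => Piece.isOldPath (hB.wf b hb)) hB.isChain_linked
  obtain ⟨Q, N, rfl, rfl, rfl⟩ := List.map_eq_cons_iff.1 hN.symm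
  obtain ⟨hQ, hNold⟩ := List.forall_mem_cons.1 hNold
  obtain ⟨Y, rfl, hY, hYlink, hYtwo, hYres⟩ := hI.lift (Q := Q)
    (fun S hS hnil => X.2.path_ne_nil S (hXS ▸ List.mem_cons_of_mem _ hS) [] hnil rfl)
    hNold hNlink (by
      rintro ⟨a, ha, hane⟩ e he
      rw [List.getLast?_map, Option.mem_map] at ha
      obtain ⟨b, hb, rfl⟩ := ha
      have hsuf : b.suf ≠ [] := by simpa using hane
      rw [hNflat, ← hB.getLast?_path hb, Piece.getLast?_path_of_suf_ne_nil hsuf] at he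
      exact (hB.wf b (List.mem_of_getLast? hb)).suf_eq e (List.mem_of_getLast? he))
  have hhead : (Q :: Y).flatten.head? = G.flatten.head? := by
    rw [← hBG, hB.head?_flatten_map_body hfirst, ← hNflat, List.flatten_cons, List.flatten_cons,
      List.head?_append_of_ne_nil _ hQ.ne_nil, List.head?_append_of_ne_nil _ hQ.ne_nil]
  refine ⟨Q :: Y, hXS, (congrArg (_ ++ ·) hYres).trans (hNres.trans hres),
    List.forall_mem_cons.2 ⟨⟨hQ.ne_nil, hQ.noJump⟩, hY⟩, hYlink,
    forall_mem_dropLast_cons (fun hYne => ?_) hYtwo, hhead⟩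
  obtain ⟨R, Y, rfl⟩ := List.exists_cons_of_ne_nil hYne
  exact hQ.two_le_length (by omega) (.inl (List.isChain_cons_cons.1 hYlink).1.1)

theorem nodup_of_nodup_filter {α : Type*} {p q : α → Bool} {l : List α}
    (hp : (l.filter p).Nodup) (hq : (l.filter q).Nodup) (hpq : ∀ a ∈ l, p a = true ∨ q a = true) :
    l.Nodup := by
  classical
  refine List.nodup_iff_count_le_one.2 fun a => ?_
  by_cases ha : a ∈ l
  · rcases hpq a ha with hpa | hqa
    · exact List.count_filter hpa ▸ List.nodup_iff_count_le_one.1 hp a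
    · exact List.count_filter hqa ▸ List.nodup_iff_count_le_one.1 hq a
  · exact (List.count_eq_zero_of_not_mem ha).trans_le zero_le_one

theorem nodup_flatten_of_restrict_of_window (hle : (restrict (i + 1) Y).flatten.Nodup)
    (hge : (vertices (Y.map (window i))).Nodup) : Y.flatten.Nodup := by
  rw [flatten_restrict] at hle
  rw [vertices_map_window] at hge
  refine nodup_of_nodup_filter hle hge.of_map fun a _ => ?_
  simp only [decide_eq_true_eq]
  omega

theorem isChain_of_restrict_of_window (hY : ∀ P ∈ Y, NoJump i P)
    (hle : ∀ x ∈ arcs (restrict (i + 1) Y), (grid h).Adj x.1 x.2)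
    (hge : ∀ x ∈ arcs (Y.map (window i)).flatten, (grid h).Adj x.1 x.2) :
    ∀ P ∈ Y, P.IsChain (grid h).Adj := by
  refine forall_isChain_iff_forall_mem_arcs.2 fun x hx => ?_
  rcases forall_isChain_iff_forall_mem_arcs.1 hY x hx with hc | hc
  · exact hle x (by rw [arcs_restrict, List.mem_filter]; exact ⟨hx, by simpa using hc⟩)
  · rw [← adj_shift hc.1 hc.2]
    refine hge (Prod.map (shift i) (shift i) x) ?_
    rw [arcs_map_window]
    exact List.mem_map_of_mem (List.mem_filter.2 ⟨hx, by simpa using hc⟩)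

theorem getLast?_filter_of_getLast? {α : Type*} {p : α → Bool} {l : List α} {a : α}
    (ha : a ∈ l.getLast?) (hpa : p a = true) : a ∈ (l.filter p).getLast? := by
  obtain ⟨m, rfl⟩ := List.getLast?_eq_some_iff.1 ha
  simp [List.filter_append, hpa]

theorem mem_of_trapped_map_window (hne : ∀ P ∈ Y, P ≠ []) (hle : ∀ p ∈ Y.flatten, p.1 ≤ i + 2)
    (htrap : ∀ S ∈ (Y.map (window i)).getLast?, ∀ e ∈ S.flatten.getLast?,
      (e.1 = 1 ∨ (e.1 = 2 ∧ S = [[e]])) → Trapped 3 (Y.map (window i)) e)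
    (he : e ∈ Y.flatten.getLast?) (hei : i + 1 ≤ e.1)
    (hcond : e.1 < i + 2 ∨ Y.getLast? = some [e]) :
    ∀ q, (grid h).Adj e q → q.1 ≤ i + 2 → q ∈ Y.flatten := by
  intro q hq hqc
  obtain ⟨Y, Q, rfl⟩ := (List.eq_nil_or_concat' Y).resolve_left (by rintro rfl; simp at he)
  have hcol := col_le_of_adj hq
  have hecol := hle e (List.mem_of_getLast? he)
  have heQ : e ∈ Q.getLast? := by
    simpa [List.getLast?_append_of_ne_nil _ (hne Q (by simp))] using he
  have heS : shift i e ∈ (window i Q).flatten.getLast? := by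
    rw [flatten_window, List.getLast?_map]
    exact Option.mem_map_of_mem _ (getLast?_filter_of_getLast? heQ (by simp; omega))
  rw [← shift_mem_vertices_map_window (by omega : i ≤ q.1)]
  refine htrap (window i Q) (by simp) _ heS ?_ _ ((adj_shift (by omega) (by omega)).2 hq)
    (by simp only [shift]; omega)
  simp only [shift]
  rcases Nat.lt_or_ge e.1 (i + 2) with hlt | hge
  · exact .inl (by omega)
  · obtain rfl : Q = [e] := by simpa using hcond.resolve_left (by omega)
    exact .inr ⟨by omega, by rw [window_eq_singleton (by simp) (by simp; omega)]; rfl⟩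

theorem IsPartialWalk.exists_extension (hG : IsPartialWalk (i + 1) G) {F : Frame h 2}
    {X : Frame h 3} (hF : F.1 = G.map (window i)) (hX : IsValidExtension F X) :
    ∃ Y : List (List (ℕ × Fin h)), IsPartialWalk (i + 2) Y ∧ Strip.restrict (i + 1) Y = G ∧
      X.1 = Y.map (window i) := by
  obtain ⟨hext, hcol, htrap⟩ := hX
  obtain ⟨Y, hXY, rfl, hY, hlink, htwo, hhead⟩ := hG.exists_lift hF hext
  have hXadj := X.2.adj_of_mem_arcs
  have hXnodup := X.2.nodup
  rw [hXY] at hXadj hXnodup htrap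
  have hle : ∀ p ∈ Y.flatten, p.1 ≤ i + 2 := fun p hp => by
    by_contra! hpi
    have := X.2.window (shift i p)
      (by rw [hXY]; exact (shift_mem_vertices_map_window (by omega)).2 hp)
    simp only [shift] at this
    omega
  refine ⟨Y, ⟨fun P hP => (hY P hP).1, ?_, ?_, hle, hhead ▸ hG.corner, hlink, htwo, ?_, ?_⟩, rfl,
    hXY⟩
  · exact isChain_of_restrict_of_window (fun P hP => (hY P hP).2) hG.adj_of_mem_arcs hXadj
  · exact nodup_flatten_of_restrict_of_window hG.nodup hXnodup
  · intro e he hcond q hq hqc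
    rcases Nat.lt_or_ge e.1 (i + 1) with hlt | hge
    · have hcolq := col_le_of_adj hq
      have heG : e ∈ (Strip.restrict (i + 1) Y).flatten.getLast? := by
        rw [flatten_restrict]
        exact getLast?_filter_of_getLast? he (by simp; omega)
      have hqG := hG.trapped e heG (.inl hlt) q hq (by omega)
      rw [flatten_restrict] at hqG
      exact List.mem_of_mem_filter hqG
    · exact mem_of_trapped_map_window (fun P hP => (hY P hP).1) hle htrap he hge hcond q hq hqc
  · obtain ⟨p, hp, hpc⟩ := hcol
    rw [hXY, vertices_map_window] at hp
    obtain ⟨q, hq, rfl⟩ := List.mem_map.1 hp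
    refine ⟨q, List.mem_of_mem_filter hq, ?_⟩
    simp only [shift] at hpc
    omega

end Extension

/-! ## Walks in the directed graph -/

section Traces

variable {h i : ℕ} {G : List (List (ℕ × Fin h))}

theorem shift_zero : (shift 0 : ℕ × Fin h → ℕ × Fin h) = id := rfl

theorem window_zero {P : List (ℕ × Fin h)} (hP : P ≠ []) : window 0 P = [P] := by
  rw [window_eq_singleton hP fun p _ => p.1.zero_le, shift_zero, List.map_id]

theorem vertices_map_window_zero (G : List (List (ℕ × Fin h))) :
    vertices (G.map (window 0)) = G.flatten := by
  rw [vertices_map_window, shift_zero, List.map_id]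
  exact List.filter_eq_self.2 fun p _ => by simp

theorem edgeCount_map_window_zero (G : List (List (ℕ × Fin h))) :
    edgeCount (G.map (window 0)) = (arcs G).length := by
  rw [edgeCount_eq_length_arcs, arcs_map_window, List.length_map,
    List.filter_eq_self.2 fun x _ => by simp]

theorem IsPartialWalk.isFirstFrame (hG : IsPartialWalk 1 G) : IsFirstFrame (G.map (window 0)) where
  single_path := List.forall_mem_map.2 fun P hP => by rw [window_zero (hG.ne_nil P hP)]; rfl
  not_point := by
    rw [← List.map_dropLast]
    refine List.forall_mem_map.2 fun P hP => ?_
    rw [window_zero (hG.ne_nil P (List.dropLast_subset _ hP)), List.flatten_singleton]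
    exact hG.two_le P hP
  corner := by
    obtain ⟨Q, T, rfl, hQ⟩ := hG.head_cons
    refine ⟨window 0 Q, rfl, ?_⟩
    rwa [window_zero (hG.ne_nil Q (by simp)), List.flatten_singleton]
  starts := startsIn_of_mem_tail (i := 0) hG
  ends := endsIn_of_mem_dropLast (i := 0) hG
  trapped := by
    intro S hS e he hcond q hq hqw
    rw [List.getLast?_map, Option.mem_map] at hS
    obtain ⟨Q, hQ, rfl⟩ := hS
    rw [window_zero (hG.ne_nil Q (List.mem_of_getLast? hQ))] at he hcond
    rw [List.flatten_singleton] at he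
    rw [vertices_map_window_zero]
    refine hG.trapped e (hG.getLast?_flatten hQ ▸ he) (hcond.imp (by omega) fun hc => ?_) q hq
      (by omega)
    rw [Option.mem_def.1 hQ, List.singleton_inj.1 hc.2]

theorem exists_col_eq_one_of_trapped (hG : G.flatten ≠ []) (hle : ∀ p ∈ G.flatten, p.1 ≤ 1)
    (htrap : ∀ e ∈ G.flatten.getLast?, e.1 < 1 → ∀ q, (grid h).Adj e q → q.1 ≤ 1 → q ∈ G.flatten) :
    ∃ p ∈ G.flatten, p.1 = 1 := by
  have hlast := List.getLast?_eq_some_getLast hG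
  generalize G.flatten.getLast hG = e at hlast
  have hmem := List.mem_of_getLast? hlast
  rcases (hle e hmem).lt_or_eq with hlt | heq
  · exact ⟨(e.1 + 1, e.2), htrap e hlast hlt _ (.inr ⟨rfl, .inl rfl⟩) hlt, by simp only; omega⟩
  · exact ⟨e, hmem, heq⟩

theorem isChain_linked_of_startsIn_of_endsIn {c : ℕ}
    (hstarts : ∀ S ∈ (G.map fun P => [P]).tail, StartsIn c S)
    (hends : ∀ S ∈ (G.map fun P => [P]).dropLast, EndsIn c S) : G.IsChain (Linked c) := by
  rw [← List.map_tail, List.forall_mem_map] at hstarts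
  rw [← List.map_dropLast, List.forall_mem_map] at hends
  refine isChain_linked_iff.2 ⟨fun P hP e he => ?_, fun P hP s hs => ?_⟩
  · obtain ⟨p, hp, hpc⟩ := hends P hP
    rw [List.flatten_singleton] at hp
    exact Option.mem_unique he hp ▸ hpc
  · obtain ⟨p, hp, hpc⟩ := hstarts P hP
    rw [List.flatten_singleton] at hp
    exact Option.mem_unique hs hp ▸ hpc

theorem IsFirstFrame.corner_flatten (hF : IsFirstFrame (G.map fun P => [P]))
    (hne : ∀ P ∈ G, P ≠ []) : ∃ p ∈ G.flatten.head?, p.1 = 0 ∧ p.2.val + 1 = h := by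
  obtain ⟨S, hS, hcorner⟩ := hF.corner
  rw [List.head?_map, Option.mem_map] at hS
  obtain ⟨P, hP, rfl⟩ := hS
  obtain ⟨G, rfl⟩ := List.head?_eq_some_iff.1 hP
  rw [List.flatten_cons, List.head?_append_of_ne_nil _ (hne P (by simp))]
  simpa using hcorner

theorem IsFirstFrame.isPartialWalk (hF : IsFirstFrame (G.map fun P => [P]))
    (hfr : IsFrame 2 (G.map fun P => [P])) : IsPartialWalk 1 G := by
  have hne : ∀ P ∈ G, P ≠ [] := fun P hP =>
    hfr.path_ne_nil [P] (List.mem_map_of_mem hP) P (by simp)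
  have hvert : vertices (G.map fun P => [P]) = G.flatten := by
    rw [← vertices_map_window_zero, List.map_congr_left fun P hP => window_zero (hne P hP)]
  have hnodup := hfr.nodup
  have hle := hfr.window
  rw [hvert] at hnodup hle
  replace hle : ∀ p ∈ G.flatten, p.1 ≤ 1 := fun p hp => Nat.lt_succ_iff.1 (hle p hp)
  have hcorner := hF.corner_flatten hne
  have htrap : ∀ e ∈ G.flatten.getLast?, (e.1 < 1 ∨ G.getLast? = some [e]) →
      ∀ q, (grid h).Adj e q → q.1 ≤ 1 → q ∈ G.flatten := by
    intro e he hcond q hq hqc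
    obtain ⟨G, Q, rfl⟩ := (List.eq_nil_or_concat' G).resolve_left (by rintro rfl; simp at he)
    rw [List.flatten_append, List.flatten_singleton,
      List.getLast?_append_of_ne_nil _ (hne Q (by simp))] at he
    have hec := Nat.le_one_iff_eq_zero_or_eq_one.1 (hle e (by simp [List.mem_of_getLast? he]))
    rw [← hvert]
    refine hF.trapped [Q] (by simp) e (by simpa using he) (hec.imp_right fun he1 => ⟨he1, ?_⟩) q hq
      (by omega)
    simpa using hcond.resolve_left (by omega)
  refine ⟨hne, fun P hP => hfr.isChain [P] (List.mem_map_of_mem hP) P (by simp), hnodup, hle,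
    hcorner, isChain_linked_of_startsIn_of_endsIn hF.starts hF.ends, ?_, htrap,
    exists_col_eq_one_of_trapped ?_ hle fun e he hlt => htrap e he (.inl hlt)⟩
  · have htwo := hF.not_point
    rw [← List.map_dropLast, List.forall_mem_map] at htwo
    simpa using htwo
  · obtain ⟨p, hp, -⟩ := hcorner
    exact List.ne_nil_of_mem (List.mem_of_mem_head? hp)

theorem IsFirstFrame.exists_isPartialWalk {F : Frame h 2} (hF : IsFirstFrame F.1) :
    ∃ G : List (List (ℕ × Fin h)), IsPartialWalk 1 G ∧ F.1 = G.map (window 0) := by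
  have hmap : F.1 = F.1.flatten.map fun P => [P] := by
    have hsingle : ∀ S ∈ F.1, (S.map fun P => [P]) = [S] := fun S hS => by
      obtain ⟨P, rfl⟩ := List.length_eq_one_iff.1 (hF.single_path S hS)
      rfl
    rw [List.map_flatten, List.map_congr_left hsingle, ← List.flatMap_def, List.flatMap_singleton']
  have hG : IsPartialWalk 1 F.1.flatten := (hmap ▸ hF).isPartialWalk (hmap ▸ F.2)
  exact ⟨F.1.flatten, hG,
    hmap.trans (List.map_congr_left fun P hP => (window_zero (hG.ne_nil P hP)).symm)⟩

/-- The number of edges of the strip that an edge of the directed graph adds, that is, the exponent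
of `x` in its weight. -/
def edgeLength {u v : State h} (e : u ⟶ v) : ℕ := e.1

/-- The number of edges of the strip that are added along a walk in the directed graph. -/
def totalLength {u v : State h} (p : Quiver.Path u v) : ℕ := p.addWeight edgeLength

theorem totalLength_nil (u : State h) : totalLength (Quiver.Path.nil : Quiver.Path u u) = 0 :=
  Quiver.Path.addWeight_nil _ _

theorem totalLength_cons {u v w : State h} (p : Quiver.Path u v) (e : v ⟶ w) :
    totalLength (p.cons e) = totalLength p + e.1 :=
  Quiver.Path.addWeight_cons _ _ _

theorem totalLength_toPath {u v : State h} (e : u ⟶ v) :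
    totalLength (Quiver.Path.nil.cons e) = e.1 := by
  rw [totalLength_cons, totalLength_nil, zero_add]

/-- The walk in the directed graph reads off the partial walk `G`: its `i`-th edge leads to the
frame that `G`, restricted to the columns `0, …, i`, shows in the columns `i - 1` and `i`, and the
first `i` edges add as many edges of the strip as that restriction has. The empty walk reads off any
`G`. -/
def Traces : ∀ {u : State h}, Quiver.Path (State.start : State h) u →
    List (List (ℕ × Fin h)) → Prop
  | _, .nil, _ => True
  | v, .cons p e, G => IsPartialWalk (p.length + 1) G ∧
      (∃ F : Frame h 2, v = .frame F ∧ F.1 = G.map (window p.length)) ∧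
      totalLength (p.cons e) = (arcs G).length ∧ Traces p (restrict p.length G)

theorem exists_traces {u : State h} (p : Quiver.Path (State.start : State h) u) :
    ∃ G, Traces p G := by
  induction p with
  | nil => exact ⟨[], trivial⟩
  | @cons v w p e ih =>
    obtain _ | F' := w
    · exact absurd e.2 (by cases v <;> simp [HasEdge])
    obtain ⟨G, hG⟩ := ih
    cases p with
    | nil =>
      have ⟨hF', hn⟩ : IsFirstFrame F'.1 ∧ e.1 = edgeCount F'.1 := e.2
      obtain ⟨G, hG, hFG⟩ := hF'.exists_isPartialWalk
      exact ⟨G, hG, ⟨F', rfl, hFG⟩,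
        by rw [totalLength_toPath, hn, hFG, edgeCount_map_window_zero], trivial⟩
    | cons p e' =>
      have hGp := hG
      obtain ⟨hwalk, ⟨F, rfl, hF⟩, htotal, -⟩ := hG
      have ⟨X, hX, hF', hn⟩ : ∃ X : Frame h 3, IsValidExtension F X ∧ F'.1 = trim X.1 ∧
          edgeCount X.1 = edgeCount F.1 + e.1 := e.2
      obtain ⟨Y, hY, rfl, hXY⟩ := hwalk.exists_extension hF hX
      refine ⟨Y, hY, ⟨F', rfl, by rw [hF', hXY, trim_map_window, Quiver.Path.length_cons]⟩, ?_, hGp⟩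
      have hcount := hY.edgeCount_map_window
      rw [← hF, ← hXY] at hcount
      rw [totalLength_cons]
      omega

theorem exists_path_of_isPartialWalk (hG : IsPartialWalk (i + 1) G) :
    ∃ (u : State h) (p : Quiver.Path (State.start : State h) u), p.length = i + 1 ∧ Traces p G := by
  induction i generalizing G with
  | zero =>
    let F : Frame h 2 := ⟨G.map (window 0), hG.isFrame (by omega) (by omega)⟩
    let e : (State.start : State h) ⟶ State.frame F := ⟨edgeCount F.1, hG.isFirstFrame, rfl⟩
    exact ⟨_, Quiver.Path.nil.cons e, rfl, hG, ⟨F, rfl, rfl⟩,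
      (totalLength_toPath e).trans (edgeCount_map_window_zero G), trivial⟩
  | succ i ih =>
    obtain ⟨u, p, hp, hT⟩ := ih (hG.restrict i.succ_pos)
    cases p with
    | nil => simp at hp
    | cons p e' =>
      have ⟨_, ⟨F, hu, hF⟩, htotal, _⟩ := hT
      subst hu
      obtain rfl : p.length = i := Nat.succ_injective hp
      let X : Frame h 3 := ⟨G.map (window p.length), hG.isFrame (by omega) (by omega)⟩
      let F' : Frame h 2 := ⟨G.map (window (p.length + 1)), hG.isFrame (by omega) (by omega)⟩
      have hle : edgeCount F.1 ≤ edgeCount X.1 := hF ▸ edgeCount_restrict_le p.length _ G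
      have hcount : _ = _ + edgeCount X.1 := hG.edgeCount_map_window
      let e : State.frame F ⟶ State.frame F' :=
        ⟨edgeCount X.1 - edgeCount F.1, X, hG.isValidExtension hF rfl, (trim_map_window _ _).symm,
          (Nat.add_sub_of_le hle).symm⟩
      refine ⟨_, (p.cons e').cons e, rfl, hG, ⟨F', rfl, rfl⟩, ?_, hT⟩
      rw [← hF] at hcount
      have he : e.1 = edgeCount X.1 - edgeCount F.1 := rfl
      rw [totalLength_cons]
      omega

theorem Traces.path_unique {u u' : State h} {p : Quiver.Path (State.start : State h) u}
    {p' : Quiver.Path (State.start : State h) u'} (hlen : p.length = p'.length)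
    (hp : Traces p G) (hp' : Traces p' G) :
    (⟨u, p⟩ : Σ u, Quiver.Path (State.start : State h) u) = ⟨u', p'⟩ := by
  induction p generalizing u' G with
  | nil =>
    cases p' with
    | nil => rfl
    | cons p' e' => simp at hlen
  | cons p e ih =>
    cases p' with
    | nil => simp at hlen
    | cons p' e' =>
      have hlen' : p.length = p'.length := Nat.succ_injective hlen
      obtain ⟨-, ⟨F, rfl, hF⟩, htotal, htraces⟩ := hp
      obtain ⟨-, ⟨F', rfl, hF'⟩, htotal', htraces'⟩ := hp'
      rw [← hlen'] at htraces' hF'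
      obtain ⟨rfl, hpp'⟩ := Sigma.mk.inj (ih hlen' htraces htraces')
      obtain rfl := eq_of_heq hpp'
      obtain rfl : F = F' := Subtype.ext (hF.trans hF'.symm)
      rw [totalLength_cons] at htotal htotal'
      obtain rfl : e = e' := Subtype.ext (by omega)
      rfl

theorem Traces.mem_arcs {u : State h} {p : Quiver.Path (State.start : State h) u}
    {G' : List (List (ℕ × Fin h))} (hlen : p.length ≠ 0) (hG : Traces p G) (hG' : Traces p G')
    {x : (ℕ × Fin h) × (ℕ × Fin h)} (hx : x ∈ arcs G) : x ∈ arcs G' := by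
  induction p generalizing G G' with
  | nil => simp at hlen
  | cons p e ih =>
    obtain ⟨hwalk, ⟨F, rfl, hF⟩, -, htraces⟩ := hG
    obtain ⟨-, ⟨F', hFF', hF'⟩, -, htraces'⟩ := hG'
    obtain rfl : F = F' := State.frame.inj hFF'
    have hcol := col_le_of_adj (hwalk.adj_of_mem_arcs x hx)
    by_cases hi : p.length ≤ x.1.1 ∧ p.length ≤ x.2.1
    · have hshift : Prod.map (shift p.length) (shift p.length) x ∈ arcs F.1.flatten := by
        rw [hF, arcs_map_window]
        exact List.mem_map_of_mem (List.mem_filter.2 ⟨hx, by simpa using hi⟩)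
      rw [hF', arcs_map_window] at hshift
      obtain ⟨y, hy, hyx⟩ := List.mem_map.1 hshift
      simp only [List.mem_filter, Bool.and_eq_true, decide_eq_true_eq] at hy
      obtain ⟨hyx₁, hyx₂⟩ := Prod.ext_iff.1 hyx
      exact (Prod.ext ((shift_inj hy.2.1 hi.1).1 hyx₁) ((shift_inj hy.2.2 hi.2).1 hyx₂) :
        y = x) ▸ hy.1
    · have hrestrict : x ∈ arcs (restrict p.length G) := by
        rw [arcs_restrict]
        refine List.mem_filter.2 ⟨hx, ?_⟩
        simp only [Bool.and_eq_true, decide_eq_true_eq]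
        omega
      have hmem := ih (by omega) htraces htraces' hrestrict
      rw [arcs_restrict] at hmem
      exact List.mem_of_mem_filter hmem

end Traces

section Bijection

variable {h : ℕ}

theorem weight_edgeWeight {u v : State h} (p : Quiver.Path u v) :
    p.weight edgeWeight = (MvPolynomial.X 0 ^ totalLength p * MvPolynomial.X 1 ^ p.length :
      MvPolynomial (Fin 2) ℤ) := by
  induction p with
  | nil => simp [totalLength_nil]
  | cons p e ih =>
    rw [Quiver.Path.weight_cons, ih, edgeWeight, totalLength_cons, Quiver.Path.length_cons]
    ring

theorem X_pow_mul_X_pow {R : Type*} [CommSemiring R] (a b : ℕ) :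
    (MvPolynomial.X 0 ^ a * MvPolynomial.X 1 ^ b : MvPolynomial (Fin 2) R) =
      MvPolynomial.monomial (Finsupp.single 0 a + Finsupp.single 1 b) 1 := by
  rw [MvPolynomial.X_pow_eq_monomial, MvPolynomial.X_pow_eq_monomial, MvPolynomial.monomial_mul,
    one_mul]

theorem single_add_single_eq_iff {a b : ℕ} {m : Fin 2 →₀ ℕ} :
    Finsupp.single 0 a + Finsupp.single 1 b = m ↔ a = m 0 ∧ b = m 1 := by
  simp [Finsupp.ext_iff, Fin.forall_fin_two]

theorem coeff_weight_edgeWeight {u v : State h} (p : Quiver.Path u v) (m : Fin 2 →₀ ℕ) :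
    MvPolynomial.coeff m (p.weight edgeWeight) =
      if totalLength p = m 0 ∧ p.length = m 1 then 1 else 0 := by
  simp only [weight_edgeWeight, X_pow_mul_X_pow, MvPolynomial.coeff_monomial,
    single_add_single_eq_iff]

theorem weight_edgeWeight_eq_iff {u v : State h} {p : Quiver.Path u v} {n k : ℕ} :
    p.weight edgeWeight =
        (MvPolynomial.X 0 ^ n * MvPolynomial.X 1 ^ k : MvPolynomial (Fin 2) ℤ) ↔
      totalLength p = n ∧ p.length = k := by
  rw [weight_edgeWeight, X_pow_mul_X_pow, X_pow_mul_X_pow,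
    (MvPolynomial.monomial_left_injective one_ne_zero).eq_iff, single_add_single_eq_iff]
  simp

theorem GSAW.ext_support {V : Type*} {G : SimpleGraph V} {v : V} {W W' : GSAW G v}
    (hW : W.walk.support = W'.walk.support) : W = W' := by
  obtain ⟨last, walk, _, _⟩ := W
  obtain ⟨last', walk', _, _⟩ := W'
  replace hW : walk.support = walk'.support := hW
  obtain rfl : last = last' := by
    rw [← walk.getLast_support, ← walk'.getLast_support]
    exact List.getLast_congr _ _ hW
  obtain rfl : walk = walk' := SimpleGraph.Walk.ext_support hW
  rfl

theorem GSAW.displacement_eq_iff {hh : 0 < h} {W : GSAW (grid h) (topLeft h hh)} {k : ℕ} :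
    W.displacement = k ↔ (∀ p ∈ W.walk.support, p.1 ≤ k) ∧ ∃ p ∈ W.walk.support, p.1 = k := by
  have hfin : (Prod.fst '' {p | p ∈ W.walk.support}).Finite :=
    (List.finite_toSet W.walk.support).image _
  have hzero : 0 ∈ Prod.fst '' {p | p ∈ W.walk.support} :=
    ⟨topLeft h hh, W.walk.start_mem_support, rfl⟩
  rw [GSAW.displacement, Nat.sInf_eq_zero.2 (Or.inl hzero), Nat.sub_zero]
  constructor
  · rintro rfl
    exact ⟨fun p hp => le_csSup hfin.bddAbove ⟨p, hp, rfl⟩, Nat.sSup_mem ⟨0, hzero⟩ hfin.bddAbove⟩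
  · rintro ⟨hle, hk⟩
    exact IsGreatest.csSup_eq ⟨hk, Set.forall_mem_image.2 hle⟩

theorem GSAW.length_arcs {V : Type*} {G : SimpleGraph V} {v : V} (W : GSAW G v) :
    (arcs [W.walk.support]).length = W.length := by
  simp [arcs, GSAW.length]

theorem eq_topLeft {hh : 0 < h} {p : ℕ × Fin h} (hcol : p.1 = 0) (hrow : p.2.val + 1 = h) :
    p = topLeft h hh :=
  Prod.ext hcol (Fin.ext (Nat.eq_sub_of_add_eq hrow))

theorem GSAW.isPartialWalk {hh : 0 < h} (W : GSAW (grid h) (topLeft h hh)) :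
    IsPartialWalk W.displacement [W.walk.support] := by
  obtain ⟨hle, hexists⟩ := GSAW.displacement_eq_iff.1 (rfl : W.displacement = _)
  have hne := W.walk.support_ne_nil
  refine ⟨by simp, by simpa using W.walk.isChain_adj_support,
    by simpa using W.isPath.support_nodup, by simpa using hle, ⟨topLeft h hh, ?_, rfl, ?_⟩,
    by simp, by simp, ?_, by simpa using hexists⟩
  · simp [List.head?_eq_some_head hne]
  · exact Nat.sub_add_cancel hh
  · intro e he _ q hq _
    rw [List.flatten_singleton] at he ⊢
    rw [List.getLast?_eq_some_getLast hne, W.walk.getLast_support] at he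
    exact W.trapped q (Option.some_injective _ he ▸ hq)

theorem IsPartialWalk.exists_gsaw {hh : 0 < h} {c : ℕ} {P : List (ℕ × Fin h)}
    (hP : IsPartialWalk c [P]) (hlast : ∀ e ∈ P.getLast?, e.1 < c) :
    ∃ W : GSAW (grid h) (topLeft h hh), W.walk.support = P ∧ W.displacement = c := by
  obtain ⟨s, hs, hcol, hrow⟩ := hP.corner
  rw [List.flatten_singleton] at hs
  obtain rfl : s = topLeft h hh := eq_topLeft hcol hrow
  obtain ⟨P, rfl⟩ := List.head?_eq_some_iff.1 hs
  have hlast' := List.getLast?_eq_some_getLast (List.cons_ne_nil (topLeft h hh) P)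
  let w : (grid h).Walk (topLeft h hh) ((topLeft h hh :: P).getLast (List.cons_ne_nil _ _)) :=
    SimpleGraph.Walk.ofSupport (topLeft h hh :: P) (List.cons_ne_nil _ _) (hP.isChain _ (by simp))
  have hsupport : w.support = topLeft h hh :: P := SimpleGraph.Walk.support_ofSupport _ _
  refine ⟨⟨_, w, ?_, fun q hq => ?_⟩, hsupport, ?_⟩
  · rw [SimpleGraph.Walk.isPath_def, hsupport]
    simpa using hP.nodup
  · rw [hsupport]
    have hlt := hlast _ hlast'
    have hq' := col_le_of_adj hq
    simpa using hP.trapped _ (by simpa using hlast') (.inl hlt) q hq (by omega)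
  · refine GSAW.displacement_eq_iff.2 ?_
    simp only [hsupport]
    exact ⟨by simpa using hP.le, by simpa using hP.exists_col⟩

theorem endsIn_zero_window_iff {i : ℕ} {P : List (ℕ × Fin h)} {e : ℕ × Fin h}
    (hP : P.IsChain (grid h).Adj) (he : e ∈ P.getLast?) (hi : ∃ p ∈ P, i ≤ p.1) :
    EndsIn 0 (window i P) ↔ e.1 ≤ i := by
  have hends : EndsIn 0 (window i P) ↔
      ∃ e' ∈ (P.filter fun p => decide (i ≤ p.1)).getLast?, e'.1 - i = 0 := by
    rw [EndsIn, flatten_window, List.getLast?_map]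
    simp only [Option.mem_map, exists_exists_and_eq_and, shift]
  rw [hends]
  constructor
  · rintro ⟨e', he', hzero⟩
    by_contra hlt
    have he'' := getLast?_filter_of_getLast? (p := fun p => decide (i ≤ p.1)) he
      (decide_eq_true (not_le.1 hlt).le)
    rw [Option.mem_unique he' he''] at hzero
    omega
  · intro hle
    obtain ⟨p, hp, hip⟩ := hi
    have hne : (P.filter fun p => decide (i ≤ p.1)) ≠ [] :=
      List.ne_nil_of_mem (List.mem_filter.2 ⟨hp, decide_eq_true hip⟩)
    refine ⟨_, List.getLast?_eq_some_getLast hne, ?_⟩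
    rcases getLast?_filter_eq_or_col_eq hP he (List.getLast?_eq_some_getLast hne) with h | h
    · rw [h]
      omega
    · omega

theorem IsPartialWalk.isAccepting_iff {i : ℕ} {G : List (List (ℕ × Fin h))} {F : Frame h 2}
    (hG : IsPartialWalk (i + 1) G) (hF : F.1 = G.map (Strip.window i)) :
    IsAccepting (.frame F) ↔ ∃ P, G = [P] ∧ ∀ e ∈ P.getLast?, e.1 < i + 1 := by
  have hsingle : ∀ P, G = [P] →
      (EndsIn 0 (Strip.window i P) ↔ ∀ e ∈ P.getLast?, e.1 < i + 1) := by
    rintro P rfl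
    obtain ⟨p, hp, hpi⟩ := hG.exists_col
    have hlast := List.getLast?_eq_some_getLast (hG.ne_nil P (by simp))
    rw [endsIn_zero_window_iff (hG.isChain P (by simp)) hlast
      ⟨p, by simpa using hp, hpi ▸ i.le_succ⟩, hlast]
    simp
  simp only [IsAccepting, hF, List.map_eq_singleton_iff]
  constructor
  · rintro ⟨S, ⟨P, hGP, rfl⟩, hS⟩
    exact ⟨P, hGP, (hsingle P hGP).1 hS⟩
  · rintro ⟨P, hGP, hP⟩
    exact ⟨_, ⟨P, hGP, rfl⟩, (hsingle P hGP).2 hP⟩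

theorem exists_gsaw_of_acceptedWalk (hh : 0 < h) {n k : ℕ} (w : AcceptedWalks h n k) :
    ∃ W : GSAWs h hh n k, Traces w.1.2 [W.1.walk.support] := by
  obtain ⟨⟨⟨t, ht⟩, p⟩, hw⟩ := w
  obtain ⟨htotal, hlen⟩ := weight_edgeWeight_eq_iff.1 hw
  obtain ⟨G, hG⟩ := exists_traces p
  cases p with
  | nil => exact ht.elim
  | cons p e =>
    have ⟨hwalk, ⟨F, hu, hF⟩, htotal', _⟩ := hG
    subst hu
    obtain ⟨P, rfl, hP⟩ := (hwalk.isAccepting_iff hF).1 ht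
    obtain ⟨W, rfl, hW⟩ := hwalk.exists_gsaw (hh := hh) hP
    exact ⟨⟨W, W.length_arcs ▸ htotal'.symm.trans htotal, hW.trans hlen⟩, hG⟩

theorem exists_acceptedWalk_of_gsaw {hh : 0 < h} {n k : ℕ} (W : GSAWs h hh n k) :
    ∃ w : AcceptedWalks h n k, Traces w.1.2 [W.1.walk.support] := by
  obtain ⟨W, rfl, hk⟩ := W
  obtain ⟨hle, -⟩ := GSAW.displacement_eq_iff.1 hk
  have hlt : W.last.1 < k := hle _ (W.trapped (W.last.1 + 1, W.last.2) (.inr ⟨rfl, .inl rfl⟩))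
  obtain ⟨i, rfl⟩ := Nat.exists_eq_add_one.2 (Nat.zero_lt_of_lt hlt)
  obtain ⟨u, p, hp, hT⟩ := exists_path_of_isPartialWalk (hk ▸ W.isPartialWalk)
  cases p with
  | nil => simp at hp
  | cons p e =>
    have ⟨hwalk, ⟨F, hu, hF⟩, htotal, _⟩ := hT
    subst hu
    obtain rfl : p.length = i := Nat.succ_injective hp
    have hF' : IsAccepting (.frame F) := (hwalk.isAccepting_iff hF).2 ⟨_, rfl, by
      simpa [List.getLast?_eq_some_getLast] using hlt⟩
    exact ⟨⟨⟨⟨_, hF'⟩, p.cons e⟩,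
      weight_edgeWeight_eq_iff.2 ⟨htotal.trans W.length_arcs, hp⟩⟩, hT⟩

theorem gsaw_unique {hh : 0 < h} {n k : ℕ} {w : AcceptedWalks h n k} {W W' : GSAWs h hh n k}
    (hW : Traces w.1.2 [W.1.walk.support]) (hW' : Traces w.1.2 [W'.1.walk.support]) : W = W' := by
  have hlen : w.1.2.length ≠ 0 := by
    obtain ⟨⟨⟨t, ht⟩, p⟩, -⟩ := w
    cases p with
    | nil => exact ht.elim
    | cons p e => simp
  refine Subtype.ext (GSAW.ext_support (eq_of_consecutivePairs W.1.isPath.support_nodup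
    W'.1.isPath.support_nodup ?_ fun x => ⟨fun hx => ?_, fun hx => ?_⟩))
  · rw [List.head?_eq_some_head W.1.walk.support_ne_nil, W.1.walk.head_support,
      List.head?_eq_some_head W'.1.walk.support_ne_nil, W'.1.walk.head_support]
  · simpa [arcs] using hW.mem_arcs hlen hW' (by simpa [arcs] using hx)
  · simpa [arcs] using hW'.mem_arcs hlen hW (by simpa [arcs] using hx)

theorem acceptedWalk_unique {n k : ℕ} {w w' : AcceptedWalks h n k} {G : List (List (ℕ × Fin h))}
    (hw : Traces w.1.2 G) (hw' : Traces w'.1.2 G) : w = w' := by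
  obtain ⟨⟨⟨t, ht⟩, p⟩, hp⟩ := w
  obtain ⟨⟨⟨t', ht'⟩, p'⟩, hp'⟩ := w'
  have hlen : p.length = p'.length :=
    (weight_edgeWeight_eq_iff.1 hp).2.trans (weight_edgeWeight_eq_iff.1 hp').2.symm
  obtain ⟨rfl, hpp'⟩ := Sigma.mk.inj (Traces.path_unique hlen hw hw')
  obtain rfl := eq_of_heq hpp'
  rfl

theorem nonempty_acceptedWalks_equiv_gsaws (hh : 0 < h) (n k : ℕ) :
    Nonempty (AcceptedWalks h n k ≃ GSAWs h hh n k) := by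
  choose f hf using exists_gsaw_of_acceptedWalk (n := n) (k := k) hh
  refine ⟨Equiv.ofBijective f ⟨fun w w' hww' => ?_, fun W => ?_⟩⟩
  · exact acceptedWalk_unique (hf w) (hww' ▸ hf w')
  · obtain ⟨w, hw⟩ := exists_acceptedWalk_of_gsaw W
    exact ⟨w, gsaw_unique (hf w) hw⟩

end Bijection

/-! ## The transfer matrix method -/

section TransferMatrix

section Paths

variable {V : Type*} [Quiver V]

/-- A walk with `j + 1` edges, split into its first `j` edges and its last one. -/
def pathSuccEquiv (u v : V) (j : ℕ) :
    {p : Quiver.Path u v // p.length = j + 1} ≃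
      Σ w, {p : Quiver.Path u w // p.length = j} × (w ⟶ v) where
  toFun
    | ⟨.cons p e, hp⟩ => ⟨_, ⟨p, Nat.succ.inj hp⟩, e⟩
  invFun x := ⟨x.2.1.1.cons x.2.2, congrArg Nat.succ x.2.1.2⟩
  left_inv
    | ⟨.cons _ _, _⟩ => rfl
  right_inv _ := rfl

instance subsingleton_path_length_zero (u v : V) :
    Subsingleton {p : Quiver.Path u v // p.length = 0} where
  allEq p q := by
    obtain rfl := Quiver.Path.eq_of_length_zero p.1 p.2
    exact Subtype.ext ((Quiver.Path.eq_nil_of_length_zero p.1 p.2).trans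
      (Quiver.Path.eq_nil_of_length_zero q.1 q.2).symm)

variable [Finite V] [∀ u v : V, Finite (u ⟶ v)]

instance finite_path_length (u v : V) (j : ℕ) :
    Finite {p : Quiver.Path u v // p.length = j} := by
  induction j generalizing v with
  | zero => infer_instance
  | succ j ih => exact Finite.of_equiv _ (pathSuccEquiv u v j).symm

end Paths

theorem pow_apply_eq_sum_weight {V R : Type*} [Quiver V] [Fintype V] [DecidableEq V]
    [∀ u v : V, Fintype (u ⟶ v)]
    [∀ (u v : V) (j : ℕ), Fintype {p : Quiver.Path u v // p.length = j}] [Semiring R]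
    (weight : ∀ {u v : V}, (u ⟶ v) → R) (u v : V) (j : ℕ) :
    ((Matrix.of fun u v : V => ∑ e : (u ⟶ v), weight e) ^ j) u v =
      ∑ p : {p : Quiver.Path u v // p.length = j}, p.1.weight weight := by
  induction j generalizing v with
  | zero =>
    rw [pow_zero]
    by_cases huv : u = v
    · subst huv
      rw [Matrix.one_apply_eq, Fintype.sum_subsingleton _ ⟨Quiver.Path.nil, rfl⟩,
        Quiver.Path.weight_nil]
    · have : IsEmpty {p : Quiver.Path u v // p.length = 0} :=
        ⟨fun p => huv (Quiver.Path.eq_of_length_zero p.1 p.2)⟩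
      rw [Matrix.one_apply_ne huv, Fintype.sum_empty]
  | succ j ih =>
    rw [pow_succ, Matrix.mul_apply, ← (pathSuccEquiv u v j).symm.sum_comp, Fintype.sum_sigma]
    refine Finset.sum_congr rfl fun w _ => ?_
    rw [ih, Matrix.of_apply, Finset.sum_mul_sum, Fintype.sum_prod_type]
    exact Finset.sum_congr rfl fun p _ => Finset.sum_congr rfl fun e _ =>
      (Quiver.Path.weight_cons weight p.1 e).symm

section PowerSeries

variable {ι σ R : Type*} [Fintype ι] [DecidableEq ι] [CommRing R]
  {A : Matrix ι ι (MvPowerSeries σ R)} {s : σ}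

theorem X_pow_dvd_pow_apply (hA : ∀ u v, MvPowerSeries.X s ∣ A u v) (k : ℕ) (u v : ι) :
    MvPowerSeries.X s ^ k ∣ (A ^ k) u v := by
  induction k generalizing v with
  | zero => simp
  | succ k ih =>
    rw [pow_succ, pow_succ, Matrix.mul_apply]
    exact Finset.dvd_sum fun w _ => mul_dvd_mul (ih w) (hA w v)

theorem isUnit_det_one_sub (hA : ∀ u v, MvPowerSeries.X s ∣ A u v) : IsUnit (1 - A).det := by
  have hmap : MvPowerSeries.constantCoeff.mapMatrix A = 0 := by
    ext u v
    simpa using MvPowerSeries.X_dvd_iff.1 (hA u v) 0 rfl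
  rw [MvPowerSeries.isUnit_iff_constantCoeff, RingHom.map_det, map_sub, hmap, map_one, sub_zero,
    Matrix.det_one]
  exact isUnit_one

theorem coeff_inv_one_sub_apply (hA : ∀ u v, MvPowerSeries.X s ∣ A u v) (m : σ →₀ ℕ) (u v : ι) :
    MvPowerSeries.coeff m ((1 - A)⁻¹ u v) =
      ∑ k ∈ Finset.range (m s + 1), MvPowerSeries.coeff m ((A ^ k) u v) := by
  have hgeom : (1 - A)⁻¹ =
      ∑ k ∈ Finset.range (m s + 1), A ^ k + A ^ (m s + 1) * (1 - A)⁻¹ := by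
    have hsum := congrArg (· * (1 - A)⁻¹) (geom_sum_mul_neg A (m s + 1))
    simp only [Matrix.mul_assoc, Matrix.mul_nonsing_inv _ (isUnit_det_one_sub hA), Matrix.mul_one,
      Matrix.sub_mul, Matrix.one_mul] at hsum
    rw [hsum, sub_add_cancel]
  have htail : MvPowerSeries.X s ^ (m s + 1) ∣ (A ^ (m s + 1) * (1 - A)⁻¹) u v := by
    rw [Matrix.mul_apply]
    exact Finset.dvd_sum fun w _ => (X_pow_dvd_pow_apply hA _ u w).mul_right _
  rw [hgeom, Matrix.add_apply, map_add, MvPowerSeries.X_pow_dvd_iff.1 htail m (Nat.lt_succ_self _),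
    add_zero, Matrix.sum_apply, map_sum]

end PowerSeries

variable {h : ℕ}

noncomputable instance fintypePathLength (u v : State h) (j : ℕ) :
    Fintype {p : Quiver.Path u v // p.length = j} := Fintype.ofFinite _

/-- The adjacency matrix over the ring of formal power series. -/
noncomputable def seriesAdjacency (h : ℕ) :
    Matrix (State h) (State h) (MvPowerSeries (Fin 2) ℤ) :=
  (MvPolynomial.coeToMvPowerSeries.ringHom (σ := Fin 2) (R := ℤ)).mapMatrix (adjacency h)

theorem oneSubAdjacency_eq (h : ℕ) : oneSubAdjacency h = 1 - seriesAdjacency h := rfl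

theorem X_dvd_seriesAdjacency (u v : State h) : MvPowerSeries.X 1 ∣ seriesAdjacency h u v := by
  have hdvd : MvPolynomial.X 1 ∣ adjacency h u v := Finset.dvd_sum fun e _ => Dvd.intro_left _ rfl
  simpa [seriesAdjacency] using map_dvd (MvPolynomial.coeToMvPowerSeries.ringHom (R := ℤ)) hdvd

theorem coeff_seriesAdjacency_pow_apply (u v : State h) (j : ℕ) (m : Fin 2 →₀ ℕ) :
    MvPowerSeries.coeff m ((seriesAdjacency h ^ j) u v) =
      ∑ p : {p : Quiver.Path u v // p.length = j},
        if totalLength p.1 = m 0 ∧ j = m 1 then 1 else 0 := by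
  rw [seriesAdjacency, ← map_pow, RingHom.mapMatrix_apply, Matrix.map_apply, adjacency,
    pow_apply_eq_sum_weight, MvPolynomial.coeToMvPowerSeries.ringHom_apply,
    MvPolynomial.coeff_coe, MvPolynomial.coeff_sum]
  exact Finset.sum_congr rfl fun p _ => by rw [coeff_weight_edgeWeight, p.2]

theorem isUnit_det_oneSubAdjacency (h : ℕ) : IsUnit (oneSubAdjacency h).det :=
  isUnit_det_one_sub X_dvd_seriesAdjacency

theorem coeff_inv_oneSubAdjacency (u v : State h) (m : Fin 2 →₀ ℕ) :
    MvPowerSeries.coeff m ((oneSubAdjacency h)⁻¹ u v) =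
      Nat.card {p : Quiver.Path u v // p.length = m 1 ∧ totalLength p = m 0} := by
  rw [oneSubAdjacency_eq, coeff_inv_one_sub_apply X_dvd_seriesAdjacency,
    Finset.sum_eq_single (m 1)]
  · rw [coeff_seriesAdjacency_pow_apply]
    simp only [and_true, Finset.sum_boole]
    rw [← Fintype.card_subtype, ← Nat.card_eq_fintype_card,
      Nat.card_congr (Equiv.subtypeSubtypeEquivSubtypeInter
        (fun p : Quiver.Path u v => p.length = m 1) fun p => totalLength p = m 0)]
  · intro j _ hj
    simp [coeff_seriesAdjacency_pow_apply, hj]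
  · simp

/-- An accepted walk, as a walk to an accepting vertex with prescribed numbers of edges. -/
def acceptedWalksEquiv (h n k : ℕ) :
    AcceptedWalks h n k ≃ Σ t : AcceptingState h,
      {p : Quiver.Path (State.start : State h) t.1 // p.length = k ∧ totalLength p = n} where
  toFun w := ⟨w.1.1, w.1.2, (weight_edgeWeight_eq_iff.1 w.2).symm⟩
  invFun x := ⟨⟨x.1, x.2.1⟩, weight_edgeWeight_eq_iff.2 x.2.2.symm⟩
  left_inv _ := rfl
  right_inv _ := rfl

instance finite_path_length_totalLength (u v : State h) (n k : ℕ) :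
    Finite {p : Quiver.Path u v // p.length = k ∧ totalLength p = n} :=
  Finite.of_injective (β := {p : Quiver.Path u v // p.length = k})
    (Subtype.map id fun _ hp => hp.1) (Subtype.map_injective _ Function.injective_id)

theorem finite_gsaws (hh : 0 < h) (n k : ℕ) : Finite (GSAWs h hh n k) := by
  obtain ⟨e⟩ := nonempty_acceptedWalks_equiv_gsaws hh n k
  exact Finite.of_equiv _ ((acceptedWalksEquiv h n k).symm.trans e)

theorem gsawSeries_eq_sum_inv (hh : 0 < h) :
    gsawSeries h hh = ∑ t : AcceptingState h, (oneSubAdjacency h)⁻¹ State.start t.1 := by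
  ext m
  obtain ⟨e⟩ := nonempty_acceptedWalks_equiv_gsaws hh (m 0) (m 1)
  have hcoeff : MvPowerSeries.coeff m (gsawSeries h hh) = Nat.card (GSAWs h hh (m 0) (m 1)) := rfl
  rw [hcoeff, map_sum, ← Nat.card_congr e, Nat.card_congr (acceptedWalksEquiv h (m 0) (m 1)),
    Nat.card_sigma]
  simp only [coeff_inv_oneSubAdjacency, Nat.cast_sum]

end TransferMatrix

end Strip

theorem mainTheorem1 (h : ℕ) (hh : 0 < h) :
    (∀ n k : ℕ, Nonempty (Strip.AcceptedWalks h n k ≃ Strip.GSAWs h hh n k)) ∧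
    (∀ n k : ℕ, Finite (Strip.GSAWs h hh n k)) ∧
    IsUnit (Strip.oneSubAdjacency h).det ∧
    Strip.gsawSeries h hh =
      ∑ t : Strip.AcceptingState h, (Strip.oneSubAdjacency h)⁻¹ Strip.State.start t.1 :=
  ⟨Strip.nonempty_acceptedWalks_equiv_gsaws hh, Strip.finite_gsaws hh,
    Strip.isUnit_det_oneSubAdjacency h, Strip.gsawSeries_eq_sum_inv hh⟩
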